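/- Let $n\ge 2$. A subspace of $\mathbb R^n$ is rational if it has a basis of vectors with rational coordinates; the height $H(B)$ of a rational subspace $B$ is the Euclidean norm of a representative of its Grassmann (Plücker) coordinates with coprime integer coordinates. For nonzero $X,Y\in\mathbb R^n$ put $\omega(X,Y)=\|X\wedge Y\|/(\|X\|\,\|Y\|)$. For $1\le e\le n-1$, a line $A\subset\mathbb R^n$ is $(e,1)$-irrational if $A\cap B=\{0\}$ for every rational subspace $B$ of dimension $e$. For such $A$, with $\psi_1(A,B)=\min\{\omega(X,Y): X\in A\setminus\{0\},\ Y\in B\setminus\{0\}\}$, let $\mu_n(A|e)_1$ be the supremum in $\mathbb R\cup\{+\infty\}$ of the set of all $\mu>0$ such that $\psi_1(A,B)\le H(B)^{-\mu}$ for infinitely many rational subspaces $B$ of dimension $e$. Let $(\gamma_k)_{k\ge 1}$ be a sequence of real numbers with $\gamma_k\ge 2+\frac{\sqrt5-1}{2}$ for all $k\ge1$, periodic of period $T\ge 1$, and let $\alpha_0=1$, $\alpha_{k+1}=\gamma_{k+1}\alpha_k$ for $k\ge 0$. Let $\theta\ge 5$ be a prime number. Then there are sequences $u^0,\dots,u^{n-2}$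 with $u^j_k\in\{1,2\}$ if $k\equiv j \pmod{n-1}$ and $u^j_k=0$ otherwise, such that the numbers $$\sigma_j=\sum_{k=0}^{\infty}\frac{u^j_k}{\theta^{\lfloor\alpha_k\rfloor}},\qquad 0\le j\le n-2,$$ are algebraically independent over $\mathbb Q$, and the line $A\subset\mathbb R^n$ spanned by $Y=(1,\sigma_0,\dots,\sigma_{n-2})$ is $(e,1)$-irrational and satisfies $$\mu_n(A|e)_1=\max_{0\le i\le T-1}\gamma_{i+1}\gamma_{i+2}\cdots\gamma_{i+e}$$ for every $e\in\{1,\dots,n-1\}$. -/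

import Mathlib

/-! Diophantine approximation of subspaces of `ℝⁿ` by rational subspaces: Grassmann coordinates,
heights, canonical angles, irrationality and Diophantine exponents. -/

noncomputable section

namespace SubspaceApprox

/-- The space `ℝⁿ` with its Euclidean structure. -/
abbrev E (n : ℕ) : Type := EuclideanSpace ℝ (Fin n)

/-- The Grassmann (Plücker) coordinate of `X₁ ∧ ⋯ ∧ X_e` indexed by `s 0 < ⋯ < s (e - 1)`:
the corresponding `e × e` minor. -/
def plucker {n e : ℕ} (X : Fin e → E n) (s : Fin e ↪o Fin n) : ℝ :=
  Matrix.det (Matrix.of fun i j : Fin e => X i (s j))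

/-- `‖X₁ ∧ ⋯ ∧ X_e‖`, the Euclidean norm of the vector of Grassmann coordinates. -/
def wedgeNorm {n e : ℕ} (X : Fin e → E n) : ℝ :=
  Real.sqrt (∑ s : Fin e ↪o Fin n, plucker X s ^ 2)

/-- The set of rational subspaces of `ℝⁿ` of dimension `e`, that is, of the subspaces having a basis
of `e` vectors with rational coordinates. -/
def rationalSubspaces (n e : ℕ) : Set (Submodule ℝ (E n)) :=
  {B | ∃ X : Fin e → E n, LinearIndependent ℝ X ∧ Submodule.span ℝ (Set.range X) = B ∧
    ∀ i j, ∃ q : ℚ, X i j = (q : ℝ)}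

/-- `η` is a representative with coprime integer coordinates of the Grassmann coordinates
(a point of a projective space) of the subspace `B`. -/
def IsPrimitivePlucker {n e : ℕ} (B : Submodule ℝ (E n)) (η : (Fin e ↪o Fin n) → ℤ) : Prop :=
  (∃ X : Fin e → E n, LinearIndependent ℝ X ∧ Submodule.span ℝ (Set.range X) = B ∧
    ∃ c : ℝ, c ≠ 0 ∧ ∀ s, (η s : ℝ) = c * plucker X s) ∧
  ∀ d : ℤ, (∀ s, d ∣ η s) → IsUnit d

/-- The height `H(B)` of a rational subspace `B` of dimension `e`: the Euclidean norm of a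
representative of its Grassmann coordinates with coprime integer coordinates. (The
representative is unique up to sign, so the infimum is that of a one-element set.) -/
def height {n : ℕ} (e : ℕ) (B : Submodule ℝ (E n)) : ℝ :=
  sInf {h : ℝ | ∃ η : (Fin e ↪o Fin n) → ℤ, IsPrimitivePlucker B η ∧
    h = Real.sqrt (∑ s, (η s : ℝ) ^ 2)}

/-- `g(d, e, n) = max (0, d + e - n)` (the subtraction of natural numbers is truncated). -/
def g (d e n : ℕ) : ℕ := d + e - n

/-- The set of the `(e, j)`-irrational subspaces of `ℝⁿ` of dimension `d`. -/
def irrationalSubspaces (n d e j : ℕ) : Set (Submodule ℝ (E n)) :=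
  {A | Module.finrank ℝ A = d ∧
    ∀ B ∈ rationalSubspaces n e, Module.finrank ℝ (A ⊓ B : Submodule ℝ (E n)) < j + g d e n}

/-- `ω(X, Y) = ‖X ∧ Y‖ / (‖X‖ ‖Y‖)`, the sine of the angle between two nonzero vectors. -/
def omega {n : ℕ} (X Y : E n) : ℝ := wedgeNorm ![X, Y] / (‖X‖ * ‖Y‖)

/-- `ω₁(A, B)`: the minimum of `ω(X, Y)` over nonzero `X ∈ A` and `Y ∈ B`. -/
def omegaMin {n : ℕ} (A B : Submodule ℝ (E n)) : ℝ :=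
  sInf {w : ℝ | ∃ X ∈ A, ∃ Y ∈ B, X ≠ 0 ∧ Y ≠ 0 ∧ w = omega X Y}

/-- A pair of nonzero vectors of `A` and `B` at which `ω₁(A, B)` is attained. -/
def minimizer {n : ℕ} (A B : Submodule ℝ (E n)) : E n × E n :=
  Classical.epsilon fun p : E n × E n =>
    p.1 ∈ A ∧ p.2 ∈ B ∧ p.1 ≠ 0 ∧ p.2 ≠ 0 ∧ omega p.1 p.2 = omegaMin A B

/-- `ω_j(A, B)` for `j ≥ 1`: `ω₁` is the minimal value of `ω`, and the following angles are
obtained by passing to the orthogonal complements, in `A` and in `B`, of minimizing vectors. -/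
def omegaAngle {n : ℕ} : ℕ → Submodule ℝ (E n) → Submodule ℝ (E n) → ℝ
  | 0, _, _ => 0
  | 1, A, B => omegaMin A B
  | j + 2, A, B =>
      omegaAngle (j + 1) (A ⊓ (Submodule.span ℝ {(minimizer A B).1})ᗮ)
        (B ⊓ (Submodule.span ℝ {(minimizer A B).2})ᗮ)

/-- `ψ_j(A, B) = ω_{j + g(d, e, n)}(A, B)` where `d = dim A` and `e = dim B`. -/
def psi {n : ℕ} (j : ℕ) (A B : Submodule ℝ (E n)) : ℝ :=
  omegaAngle (j + g (Module.finrank ℝ A) (Module.finrank ℝ B) n) A B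

/-- The Diophantine exponent `μ_n(A | e)_j`: the supremum, in the extended reals, of the `μ > 0`
for which `ψ_j(A, B) ≤ H(B) ^ (-μ)` for infinitely many rational subspaces `B` of
dimension `e`. -/
def exponent {n : ℕ} (A : Submodule ℝ (E n)) (e j : ℕ) : EReal :=
  sSup ((fun μ : ℝ => (μ : EReal)) '' {μ : ℝ | 0 < μ ∧
    {B : Submodule ℝ (E n) | B ∈ rationalSubspaces n e ∧
      psi j A B ≤ height e B ^ (-μ)}.Infinite})

/-- The sequence `α₀ = 1`, `α_{k+1} = γ_{k+1} α_k`. -/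
def alpha (γ : ℕ → ℝ) : ℕ → ℝ
  | 0 => 1
  | k + 1 => γ (k + 1) * alpha γ k

end SubspaceApprox

end

noncomputable section

namespace SubspaceApprox

/-! Write n = r + 2, q_k = θ^⌊α_k⌋, and let Y_N be the truncation of Y after the term of index N.
Passing from Y_N to Y_{N+1} moves a single coordinate, in cyclic order, so Y_N, …, Y_{N+m} span the
same subspace B_{N,m} as Y_N and m distinct basis vectors (m ≤ r). Two estimates govern this
subspace of dimension e = m + 1. Its height is q_N up to a constant (`q_le_height`,
`height_approxSpan_le`), because its integer minors include ±q_N and a number prime to θ. Its angle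
with Y is 1/q_{N+e} up to a constant (`omegaMin_approxSpan_le`, `inv_q_le_norm_limit_sub`). These
subspaces therefore give the exponents α_{N+e}/α_N = γ_{N+1}⋯γ_{N+e}, and the maximum P over a
period recurs infinitely often (`infinite_of_lt`).

No other subspace does better (`finite_of_lt`). An integer vector outside a rational subspace B is
at distance at least 1/H(B) from it. Hence, if B is very close to Y and q_{k+1}/q_k is large
compared with H(B), then Y_k lies in B (`approx_mem_of_omegaMin_le`). Let N be the first index at
which the gap α_{N+1} - α_N exceeds log_θ H(B) by a fixed margin. The lower bound on the γ_k,
through `alpha_add_le_mul_gap`, keeps q_{N+m} small enough for this argument to apply to all of Y_N,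
…, Y_{N+m}. So B = B_{N,m}, and the two estimates rule out an exponent above P once H(B) is large.

None of this depends on the digits in {1, 2}. Each σ_j thus ranges over an uncountable set, while
only countably many reals are algebraic over the numbers already chosen; this gives algebraic
independence. Irrationality follows, since a proper rational subspace satisfies a nontrivial integer
linear equation. -/

/-! ### Grassmann coordinates, heights and a Liouville inequality. -/

/-- The coordinates of `ℝⁿ` indexed by `s`, as a linear map. -/
def coordMap {n e : ℕ} (s : Fin e → Fin n) : E n →ₗ[ℝ] (Fin e → ℝ) where
  toFun y := fun j => y (s j)
  map_add' _ _ := rfl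
  map_smul' _ _ := rfl

theorem exists_plucker_ne_zero {n e : ℕ} {X : Fin e → E n} (hX : LinearIndependent ℝ X) :
    ∃ s, plucker X s ≠ 0 := by
  set M : Matrix (Fin e) (Fin n) ℝ := Matrix.of fun i j => X i j with hM
  have hrows : LinearIndependent ℝ M.row := by
    have := hX.map' (coordMap (id : Fin n → Fin n)) (LinearMap.ker_eq_bot.2 fun x y h => by
      ext i; exact congrFun h i)
    exact this
  have hrank : M.rank = e := by simpa using hrows.rank_matrix
  obtain ⟨κ, a, ha, hspan, hli⟩ := exists_linearIndependent' ℝ M.col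
  have : Finite κ := Finite.of_injective a ha
  have := Fintype.ofFinite κ
  have hcard : Fintype.card κ = e := by
    rw [← finrank_span_eq_card hli, hspan, ← Matrix.rank_eq_finrank_span_cols, hrank]
  classical
  set t : Finset (Fin n) := Finset.univ.image a with ht
  have htc : t.card = e := by
    rw [ht, Finset.card_image_of_injective _ ha, Finset.card_univ, hcard]
  refine ⟨t.orderEmbOfFin htc, ?_⟩
  have hmem : ∀ i, ∃ k, a k = t.orderEmbOfFin htc i := fun i => by
    obtain ⟨k, -, hk⟩ := Finset.mem_image.1 (t.orderEmbOfFin_mem htc i)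
    exact ⟨k, hk⟩
  choose b hb using hmem
  have hbinj : Function.Injective b := fun i j hij => by
    apply (t.orderEmbOfFin htc).injective
    rw [← hb, ← hb, hij]
  have h2 := hli.comp b hbinj
  have h3 : LinearIndependent ℝ
      (Matrix.of fun i j : Fin e => X i (t.orderEmbOfFin htc j)).col := by
    have h4 : (Matrix.of fun i j : Fin e => X i (t.orderEmbOfFin htc j)).col =
        (M.col ∘ a) ∘ b := by
      funext j i
      change X i (t.orderEmbOfFin htc j) = X i (a (b j))
      rw [hb]
    rw [h4]
    exact h2
  exact ((Matrix.isUnit_iff_isUnit_det _).1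
    (Matrix.linearIndependent_cols_iff_isUnit.1 h3)).ne_zero

theorem linearIndependent_of_plucker_ne_zero {n e : ℕ} {X : Fin e → E n} {s : Fin e ↪o Fin n}
    (h : plucker X s ≠ 0) : LinearIndependent ℝ X := by
  have h1 : LinearIndependent ℝ (Matrix.of fun i j : Fin e => X i (s j)).row :=
    Matrix.linearIndependent_rows_iff_isUnit.2
      ((Matrix.isUnit_iff_isUnit_det _).2 (isUnit_iff_ne_zero.2 h))
  exact LinearIndependent.of_comp (coordMap s) h1

theorem exists_plucker_eq_mul {n e : ℕ} {X X' : Fin e → E n}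
    (h : ∀ i, X' i ∈ Submodule.span ℝ (Set.range X)) :
    ∃ d : ℝ, ∀ s, plucker X' s = d * plucker X s := by
  choose P hP using fun i => (Submodule.mem_span_range_iff_exists_fun ℝ).1 (h i)
  refine ⟨(Matrix.of P).det, fun s => ?_⟩
  rw [plucker, plucker, ← Matrix.det_mul]
  congr 1
  ext i j
  simp [Matrix.mul_apply, ← hP i]

/-- The coordinate indexed by `s` of `y ∧ η`. -/
def wedgeCoord {n e : ℕ} (η : (Fin e ↪o Fin n) → ℝ) (s : Fin (e + 1) ↪o Fin n) (y : E n) : ℝ :=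
  ∑ j : Fin (e + 1), (-1) ^ (j : ℕ) * y (s j) * η ((Fin.succAboveOrderEmb j).trans s)

theorem plucker_cons {n e : ℕ} (y : E n) (X : Fin e → E n) (s : Fin (e + 1) ↪o Fin n) :
    plucker (Fin.cons y X : Fin (e + 1) → E n) s = wedgeCoord (plucker X) s y := by
  rw [plucker, Matrix.det_succ_row_zero, wedgeCoord]
  rfl

theorem wedgeCoord_smul_left {n e : ℕ} (c : ℝ) (η : (Fin e ↪o Fin n) → ℝ)
    (s : Fin (e + 1) ↪o Fin n) (y : E n) :
    wedgeCoord (fun t => c * η t) s y = c * wedgeCoord η s y := by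
  simp only [wedgeCoord, Finset.mul_sum]
  exact Finset.sum_congr rfl fun j _ => by ring

theorem wedgeCoord_sub {n e : ℕ} (η : (Fin e ↪o Fin n) → ℝ)
    (s : Fin (e + 1) ↪o Fin n) (y z : E n) :
    wedgeCoord η s (y - z) = wedgeCoord η s y - wedgeCoord η s z := by
  simp only [wedgeCoord, ← Finset.sum_sub_distrib]
  exact Finset.sum_congr rfl fun j _ => by simp; ring

/-- Grassmann coordinates give explicit linear equations of the subspace, with integer coefficients
when the coordinates are integers. -/
theorem mem_span_iff_wedgeCoord {n e : ℕ} {X : Fin e → E n} (hX : LinearIndependent ℝ X)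
    (y : E n) :
    y ∈ Submodule.span ℝ (Set.range X) ↔ ∀ s, wedgeCoord (plucker X) s y = 0 := by
  constructor
  · intro h s
    by_contra h0
    rw [← plucker_cons] at h0
    exact (linearIndependent_finCons.1 (linearIndependent_of_plucker_ne_zero h0)).2 h
  · intro h
    by_contra h0
    obtain ⟨s, hs⟩ := exists_plucker_ne_zero (linearIndependent_finCons.2 ⟨hX, h0⟩)
    exact hs (by rw [plucker_cons, h s])

theorem IsPrimitivePlucker.mem_iff {n e : ℕ} {B : Submodule ℝ (E n)} {η : (Fin e ↪o Fin n) → ℤ}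
    (h : IsPrimitivePlucker B η) (y : E n) :
    y ∈ B ↔ ∀ s, wedgeCoord (fun t => (η t : ℝ)) s y = 0 := by
  obtain ⟨⟨X, hX, rfl, c, hc, hη⟩, -⟩ := h
  rw [mem_span_iff_wedgeCoord hX]
  simp only [hη, wedgeCoord_smul_left, mul_eq_zero, hc, false_or]

theorem succAbove_trans_injective {n e : ℕ} (s : Fin (e + 1) ↪o Fin n) :
    Function.Injective fun j : Fin (e + 1) => (Fin.succAboveOrderEmb j).trans s := by
  intro i j hij
  have h : i.succAbove = j.succAbove := by
    funext k
    apply s.injective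
    exact DFunLike.congr_fun hij k
  exact Fin.succAbove_left_injective h

theorem sum_comp_sq_le {ι κ : Type*} [Fintype ι] [Fintype κ] {f : ι → κ}
    (hf : Function.Injective f) (v : κ → ℝ) : ∑ i, v (f i) ^ 2 ≤ ∑ k, v k ^ 2 := by
  refine le_trans (le_of_eq ?_) (Finset.sum_le_sum_of_subset_of_nonneg
    (Finset.subset_univ (Finset.univ.map ⟨f, hf⟩)) fun _ _ _ => sq_nonneg _)
  rw [Finset.sum_map]
  rfl

theorem abs_wedgeCoord_le {n e : ℕ} (η : (Fin e ↪o Fin n) → ℝ) (s : Fin (e + 1) ↪o Fin n)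
    (y : E n) : |wedgeCoord η s y| ≤ ‖y‖ * Real.sqrt (∑ t, η t ^ 2) := by
  have h1 : |wedgeCoord η s y| ≤ ∑ j : Fin (e + 1), |y (s j)| *
      |η ((Fin.succAboveOrderEmb j).trans s)| := by
    refine (Finset.abs_sum_le_sum_abs _ _).trans (le_of_eq ?_)
    exact Finset.sum_congr rfl fun j _ => by simp [abs_mul]
  refine h1.trans ((Real.sum_mul_le_sqrt_mul_sqrt _ _ _).trans ?_)
  rw [EuclideanSpace.norm_eq]
  simp only [sq_abs, Real.norm_eq_abs]
  gcongr
  · exact sum_comp_sq_le s.injective fun i => y i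
  · exact sum_comp_sq_le (succAbove_trans_injective s) η

/-- Liouville's argument: some coordinate of `x ∧ η` is a nonzero integer, and it is unchanged when
`x` is replaced by `x - b`. -/
theorem IsPrimitivePlucker.one_le_mul_norm_sub {n e : ℕ} {B : Submodule ℝ (E n)}
    {η : (Fin e ↪o Fin n) → ℤ} (h : IsPrimitivePlucker B η) {x : E n}
    (hx : ∀ i, ∃ m : ℤ, x i = m) (hxB : x ∉ B) {b : E n} (hb : b ∈ B) :
    1 ≤ ‖x - b‖ * Real.sqrt (∑ t, (η t : ℝ) ^ 2) := by
  choose m hm using hx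
  rw [h.mem_iff] at hxB
  push Not at hxB
  obtain ⟨s, hs⟩ := hxB
  refine le_trans ?_ (abs_wedgeCoord_le (fun t => (η t : ℝ)) s (x - b))
  rw [wedgeCoord_sub, (h.mem_iff b).1 hb s, sub_zero]
  have : wedgeCoord (fun t => (η t : ℝ)) s x = ((∑ j : Fin (e + 1), (-1) ^ (j : ℕ) * m (s j) *
      η ((Fin.succAboveOrderEmb j).trans s) : ℤ) : ℝ) := by
    simp [wedgeCoord, hm]
  rw [this] at hs ⊢
  exact_mod_cast Int.one_le_abs (by exact_mod_cast hs)

theorem exists_primitive_multiple {ι : Type*} [Fintype ι] (v : ι → ℚ) (hv : ∃ i, v i ≠ 0) :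
    ∃ (η : ι → ℤ) (c : ℚ), c ≠ 0 ∧ (∀ i, (η i : ℚ) = c * v i) ∧
      ∀ d : ℤ, (∀ i, d ∣ η i) → IsUnit d := by
  obtain ⟨b, hb⟩ := IsLocalization.exist_integer_multiples_of_finite (nonZeroDivisors ℤ) v
  choose f hf using hb
  have hb0 : ((b : ℤ) : ℚ) ≠ 0 := by
    exact_mod_cast nonZeroDivisors.coe_ne_zero b
  obtain ⟨i, hi⟩ := hv
  have hf' : ∀ i, (f i : ℚ) = (b : ℤ) * v i := fun i => by
    have := hf i
    simpa using this
  obtain ⟨g, hg, hg1⟩ := Finset.extract_gcd f (s := Finset.univ) ⟨i, Finset.mem_univ i⟩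
  set G : ℤ := Finset.univ.gcd f with hG
  have hG0 : (G : ℚ) ≠ 0 := by
    intro h0
    have h1 : (f i : ℚ) = 0 := by
      rw [hg i (Finset.mem_univ i)]; push_cast; rw [h0, zero_mul]
    rw [hf'] at h1
    exact (mul_ne_zero hb0 hi) h1
  refine ⟨g, (b : ℤ) / G, div_ne_zero hb0 hG0, fun i => ?_, fun d hd => ?_⟩
  · have h1 : (f i : ℚ) = G * g i := by
      have := hg i (Finset.mem_univ i)
      exact_mod_cast this
    rw [hf'] at h1
    field_simp
    linarith
  · have : d ∣ Finset.univ.gcd g := Finset.dvd_gcd fun i _ => hd i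
    rw [hg1] at this
    exact isUnit_of_dvd_one this

theorem exists_isPrimitivePlucker {n e : ℕ} {B : Submodule ℝ (E n)}
    (hB : B ∈ rationalSubspaces n e) :
    ∃ η : (Fin e ↪o Fin n) → ℤ, IsPrimitivePlucker B η := by
  obtain ⟨X, hX, hspan, hq⟩ := hB
  choose Q hQ using hq
  set v : (Fin e ↪o Fin n) → ℚ := fun s => Matrix.det (Matrix.of fun i j => Q i (s j)) with hv
  have hvX : ∀ s, (v s : ℝ) = plucker X s := fun s => by
    rw [hv, plucker]
    have := RingHom.map_det (Rat.castHom ℝ) (Matrix.of fun i j => Q i (s j))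
    simp only [Rat.coe_castHom] at this
    rw [this]
    congr 1
    ext i j
    simp [hQ]
  obtain ⟨s, hs⟩ := exists_plucker_ne_zero hX
  obtain ⟨η, c, hc, hη, hprim⟩ := exists_primitive_multiple v ⟨s, fun h => hs (by
    rw [← hvX, h, Rat.cast_zero])⟩
  refine ⟨η, ⟨X, hX, hspan, c, by exact_mod_cast hc, fun s => ?_⟩, hprim⟩
  rw [← hvX]
  exact_mod_cast hη s

theorem height_le {n e : ℕ} {B : Submodule ℝ (E n)} {η : (Fin e ↪o Fin n) → ℤ}
    (h : IsPrimitivePlucker B η) : height e B ≤ Real.sqrt (∑ s, (η s : ℝ) ^ 2) :=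
  csInf_le ⟨0, by rintro _ ⟨η, -, rfl⟩; positivity⟩ ⟨η, h, rfl⟩

theorem le_height {n e : ℕ} {B : Submodule ℝ (E n)} (hB : B ∈ rationalSubspaces n e) {K : ℝ}
    (h : ∀ η : (Fin e ↪o Fin n) → ℤ, IsPrimitivePlucker B η →
      K ≤ Real.sqrt (∑ s, (η s : ℝ) ^ 2)) : K ≤ height e B := by
  obtain ⟨η, hη⟩ := exists_isPrimitivePlucker hB
  exact le_csInf ⟨_, η, hη, rfl⟩ (by rintro _ ⟨η, hη, rfl⟩; exact h η hη)

theorem abs_le_sqrt_sum {ι : Type*} [Fintype ι] (v : ι → ℝ) (i : ι) :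
    |v i| ≤ Real.sqrt (∑ j, v j ^ 2) := by
  apply Real.abs_le_sqrt
  exact Finset.single_le_sum (f := fun j => v j ^ 2) (fun _ _ => sq_nonneg _) (Finset.mem_univ i)

theorem one_le_height {n e : ℕ} {B : Submodule ℝ (E n)} (hB : B ∈ rationalSubspaces n e) :
    1 ≤ height e B := by
  refine le_height hB fun η hη => ?_
  obtain ⟨⟨X, hX, -, c, hc, h⟩, -⟩ := hη
  obtain ⟨s, hs⟩ := exists_plucker_ne_zero hX
  refine le_trans ?_ (abs_le_sqrt_sum (fun s => (η s : ℝ)) s)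
  have : (η s : ℝ) ≠ 0 := by rw [h]; exact mul_ne_zero hc hs
  exact_mod_cast Int.one_le_abs (by exact_mod_cast this)

theorem one_le_height_mul_norm_sub {n e : ℕ} {B : Submodule ℝ (E n)}
    (hB : B ∈ rationalSubspaces n e) {x : E n}
    (hx : ∀ i, ∃ m : ℤ, x i = m) (hxB : x ∉ B) {b : E n} (hb : b ∈ B) :
    1 ≤ height e B * ‖x - b‖ := by
  have h0 : 0 < ‖x - b‖ := norm_pos_iff.2 fun h => hxB (by rwa [sub_eq_zero.1 h])
  rw [← div_le_iff₀ h0]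
  refine le_height hB fun η hη => ?_
  rw [div_le_iff₀ h0, mul_comm]
  exact hη.one_le_mul_norm_sub hx hxB hb

theorem IsPrimitivePlucker.subspace_unique {n e : ℕ} {B B' : Submodule ℝ (E n)}
    {η : (Fin e ↪o Fin n) → ℤ} (h : IsPrimitivePlucker B η) (h' : IsPrimitivePlucker B' η) :
    B = B' := by
  ext y
  rw [h.mem_iff, h'.mem_iff]

/-- Northcott's finiteness: a subspace is determined by an integer Grassmann vector, and bounded
integer vectors are finite in number. -/
theorem finite_height_le (n e : ℕ) (K : ℝ) :
    {B : Submodule ℝ (E n) | B ∈ rationalSubspaces n e ∧ height e B ≤ K}.Finite := by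
  have hex : ∀ B : Submodule ℝ (E n), ∃ η : (Fin e ↪o Fin n) → ℤ,
      B ∈ rationalSubspaces n e → height e B ≤ K →
        IsPrimitivePlucker B η ∧ Real.sqrt (∑ s, (η s : ℝ) ^ 2) < K + 1 := by
    intro B
    by_cases hB : B ∈ rationalSubspaces n e ∧ height e B ≤ K
    -- The slack `1` gives a representative close to the infimum without proving that the infimum is
    -- attained.
    · have h1 : height e B < K + 1 := by linarith [hB.2]
      obtain ⟨η₀, hη₀⟩ := exists_isPrimitivePlucker hB.1
      obtain ⟨_, ⟨η, hη, rfl⟩, hlt⟩ := exists_lt_of_csInf_lt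
        (⟨_, η₀, hη₀, rfl⟩ : {h : ℝ | ∃ η : (Fin e ↪o Fin n) → ℤ, IsPrimitivePlucker B η ∧
          h = Real.sqrt (∑ s, (η s : ℝ) ^ 2)}.Nonempty) h1
      exact ⟨η, fun _ _ => ⟨hη, hlt⟩⟩
    · exact ⟨0, fun h1 h2 => absurd ⟨h1, h2⟩ hB⟩
  choose F hF using hex
  refine Set.Finite.of_finite_image (f := F) ?_ ?_
  · refine (Set.finite_Icc (fun _ : Fin e ↪o Fin n => -⌈K + 1⌉) (fun _ => ⌈K + 1⌉)).subset ?_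
    rintro _ ⟨B, ⟨hB, hK⟩, rfl⟩
    have h2 : ∀ s, |F B s| ≤ ⌈K + 1⌉ := fun s => by
      have h3 := (abs_le_sqrt_sum (fun s => (F B s : ℝ)) s).trans (hF B hB hK).2.le
      have h4 := h3.trans (Int.le_ceil _)
      exact_mod_cast h4
    exact ⟨fun s => (abs_le.1 (h2 s)).1, fun s => (abs_le.1 (h2 s)).2⟩
  · rintro B ⟨hB, hK⟩ B' ⟨hB', hK'⟩ h
    have h1 := (hF B hB hK).1
    rw [h] at h1
    exact h1.subspace_unique (hF B' hB' hK').1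

/-! ### The angle between a line and a subspace, expressed by distances. -/

theorem plucker_pair {n : ℕ} (X Z : E n) (s : Fin 2 ↪o Fin n) :
    plucker ![X, Z] s = X (s 0) * Z (s 1) - X (s 1) * Z (s 0) := by
  simp [plucker, Matrix.det_fin_two]

theorem sum_orderEmb_two {n : ℕ} (f : Fin n → Fin n → ℝ) :
    ∑ s : Fin 2 ↪o Fin n, f (s 0) (s 1) = ∑ i, ∑ j, if i < j then f i j else 0 := by
  rw [← Finset.sum_product', Finset.univ_product_univ, ← Finset.sum_filter]
  refine Finset.sum_bij (fun s _ => (s 0, s 1)) (fun s _ => ?_) (fun s _ t _ h => ?_)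
    (fun p hp => ?_) (fun _ _ => rfl)
  · simp
  · ext i
    simp only [Prod.mk.injEq] at h
    fin_cases i
    · simp [h.1]
    · simp [h.2]
  · have hlt : p.1 < p.2 := by simpa using hp
    refine ⟨OrderEmbedding.ofStrictMono ![p.1, p.2] ?_, Finset.mem_univ _, rfl⟩
    intro i j hij
    fin_cases i <;> fin_cases j <;> simp_all

/-- Lagrange's identity. -/
theorem wedgeNorm_sq {n : ℕ} (X Z : E n) :
    wedgeNorm ![X, Z] ^ 2 = ‖X‖ ^ 2 * ‖Z‖ ^ 2 - inner ℝ X Z ^ 2 := by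
  rw [wedgeNorm, Real.sq_sqrt (Finset.sum_nonneg fun _ _ => sq_nonneg _)]
  simp only [plucker_pair]
  rw [sum_orderEmb_two fun i j => (X i * Z j - X j * Z i) ^ 2]
  rw [EuclideanSpace.real_norm_sq_eq, EuclideanSpace.real_norm_sq_eq, PiLp.inner_apply]
  have hsymm : ∑ i, ∑ j, (if i < j then (X i * Z j - X j * Z i) ^ 2 else 0) =
      ∑ i, ∑ j, (if j < i then (X i * Z j - X j * Z i) ^ 2 else 0) := by
    rw [Finset.sum_comm]
    refine Finset.sum_congr rfl fun i _ => Finset.sum_congr rfl fun j _ => ?_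
    split_ifs <;> ring
  have hall : (∑ i, ∑ j, (if i < j then (X i * Z j - X j * Z i) ^ 2 else 0)) +
      ∑ i, ∑ j, (if j < i then (X i * Z j - X j * Z i) ^ 2 else 0) =
      ∑ i, ∑ j, (X i * Z j - X j * Z i) ^ 2 := by
    simp only [← Finset.sum_add_distrib]
    refine Finset.sum_congr rfl fun i _ => Finset.sum_congr rfl fun j _ => ?_
    rcases lt_trichotomy i j with h | h | h
    · simp [h, h.le]
    · simp [h]
    · simp [h, h.le]
  have hexp : ∑ i, ∑ j, (X i * Z j - X j * Z i) ^ 2 =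
      2 * ((∑ i, X i ^ 2) * (∑ i, Z i ^ 2) - (∑ i, X i * Z i) ^ 2) := by
    have h1 : ∑ i, ∑ j, (X i * Z j - X j * Z i) ^ 2 =
        ∑ i, ∑ j, (X i ^ 2 * Z j ^ 2 + Z i ^ 2 * X j ^ 2 - 2 * ((X i * Z i) * (X j * Z j))) :=
      Finset.sum_congr rfl fun i _ => Finset.sum_congr rfl fun j _ => by ring
    rw [h1]
    simp only [Finset.sum_sub_distrib, Finset.sum_add_distrib, ← Finset.mul_sum,
      ← Finset.sum_mul]
    ring
  have hin : ∑ i, inner ℝ (X i) (Z i) = ∑ i, X i * Z i :=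
    Finset.sum_congr rfl fun i _ => by simp [mul_comm]
  rw [hin]
  linarith

theorem wedgeNorm_nonneg {n e : ℕ} (X : Fin e → E n) : 0 ≤ wedgeNorm X := Real.sqrt_nonneg _

theorem omega_nonneg {n : ℕ} (X Z : E n) : 0 ≤ omega X Z :=
  div_nonneg (wedgeNorm_nonneg _) (by positivity)

theorem omega_mul_norm_le {n : ℕ} {X Z : E n} (hX : X ≠ 0) (hZ : Z ≠ 0) :
    omega X Z * ‖X‖ ≤ ‖X - Z‖ := by
  have hX' := norm_pos_iff.2 hX
  have hZ' := norm_pos_iff.2 hZ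
  have h1 : omega X Z * ‖X‖ = wedgeNorm ![X, Z] / ‖Z‖ := by
    rw [omega]; field_simp
  rw [h1, div_le_iff₀ hZ']
  refine le_of_sq_le_sq ?_ (by positivity)
  rw [wedgeNorm_sq, mul_pow, norm_sub_sq_real]
  nlinarith [sq_nonneg (‖Z‖ ^ 2 - inner ℝ X Z)]

/-- The witness is the coefficient of the orthogonal projection of `X` onto the line of `Z`. -/
theorem exists_norm_sub_smul_eq {n : ℕ} {X Z : E n} (hX : X ≠ 0) (hZ : Z ≠ 0) :
    ∃ t : ℝ, ‖X - t • Z‖ = omega X Z * ‖X‖ := by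
  have hX' := norm_pos_iff.2 hX
  have hZ' := norm_pos_iff.2 hZ
  have h1 : omega X Z * ‖X‖ = wedgeNorm ![X, Z] / ‖Z‖ := by
    rw [omega]; field_simp
  refine ⟨inner ℝ X Z / ‖Z‖ ^ 2, ?_⟩
  rw [h1, eq_div_iff hZ'.ne']
  refine (sq_eq_sq₀ (by positivity) (wedgeNorm_nonneg _)).1 ?_
  rw [wedgeNorm_sq, mul_pow, norm_sub_sq_real, inner_smul_right, norm_smul, Real.norm_eq_abs,
    mul_pow, sq_abs]
  field_simp
  ring

theorem bddBelow_omega {n : ℕ} (A B : Submodule ℝ (E n)) :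
    BddBelow {w : ℝ | ∃ X ∈ A, ∃ Y ∈ B, X ≠ 0 ∧ Y ≠ 0 ∧ w = omega X Y} :=
  ⟨0, by rintro _ ⟨X, -, Y, -, -, -, rfl⟩; exact omega_nonneg X Y⟩

theorem omegaMin_mul_norm_le {n : ℕ} {Y b : E n} {B : Submodule ℝ (E n)} (hY : Y ≠ 0)
    (hb : b ∈ B) (hb0 : b ≠ 0) : omegaMin (Submodule.span ℝ {Y}) B * ‖Y‖ ≤ ‖Y - b‖ := by
  refine le_trans ?_ (omega_mul_norm_le hY hb0)
  gcongr
  exact csInf_le (bddBelow_omega _ _)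
    ⟨Y, Submodule.mem_span_singleton_self Y, b, hb, hY, hb0, rfl⟩

/-- `B ≠ ⊥` is essential: otherwise the infimum is over the empty set and takes the default value 0.
The bound is required at `b = 0` too, as the projection of `Y` may vanish. -/
theorem le_omegaMin_mul_norm {n : ℕ} {Y : E n} {B : Submodule ℝ (E n)} (hY : Y ≠ 0)
    (hB : B ≠ ⊥) {K : ℝ} (hK : ∀ b ∈ B, K ≤ ‖Y - b‖) :
    K ≤ omegaMin (Submodule.span ℝ {Y}) B * ‖Y‖ := by
  have hY' := norm_pos_iff.2 hY
  rw [← div_le_iff₀ hY']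
  obtain ⟨b₀, hb₀, hb₀'⟩ := Submodule.exists_mem_ne_zero_of_ne_bot hB
  refine le_csInf ⟨_, Y, Submodule.mem_span_singleton_self Y, b₀, hb₀, hY, hb₀', rfl⟩ ?_
  rintro _ ⟨X, hX, b, hb, hX0, hb0, rfl⟩
  obtain ⟨c, rfl⟩ := Submodule.mem_span_singleton.1 hX
  have hc : c ≠ 0 := fun h => hX0 (by rw [h, zero_smul])
  have hc' := abs_pos.2 hc
  obtain ⟨t, ht⟩ := exists_norm_sub_smul_eq hX0 hb0
  have h1 := hK (c⁻¹ • t • b) (B.smul_mem _ (B.smul_mem _ hb))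
  have h2 : c • Y - t • b = c • (Y - c⁻¹ • t • b) := by
    rw [smul_sub, smul_inv_smul₀ hc]
  rw [h2, norm_smul, norm_smul, Real.norm_eq_abs] at ht
  rw [div_le_iff₀ hY']
  have h3 : ‖Y - c⁻¹ • t • b‖ = omega (c • Y) b * ‖Y‖ := by
    apply mul_left_cancel₀ hc'.ne'
    linarith
  linarith

theorem finrank_of_mem_rationalSubspaces {n e : ℕ} {B : Submodule ℝ (E n)}
    (hB : B ∈ rationalSubspaces n e) : Module.finrank ℝ B = e := by
  obtain ⟨X, hX, rfl, -⟩ := hB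
  simpa using finrank_span_eq_card hX

theorem psi_one_span_singleton {n e : ℕ} {Y : E n} (hY : Y ≠ 0) {B : Submodule ℝ (E n)}
    (hB : B ∈ rationalSubspaces n e) (he : e < n) :
    psi 1 (Submodule.span ℝ {Y}) B = omegaMin (Submodule.span ℝ {Y}) B := by
  rw [psi, finrank_of_mem_rationalSubspaces hB, finrank_span_singleton hY, g,
    show 1 + e - n = 0 by omega]
  rfl

theorem ne_bot_of_mem_rationalSubspaces {n e : ℕ} (he : 1 ≤ e) {B : Submodule ℝ (E n)}
    (hB : B ∈ rationalSubspaces n e) : B ≠ ⊥ := by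
  rintro rfl
  have := finrank_of_mem_rationalSubspaces hB
  rw [finrank_bot] at this
  omega

/-! ### Lacunary scales and geometric tails. -/

/-- The exponents `a 0 < a 1 < ⋯` of a lacunary series in the powers of a prime `θ ≥ 5`. -/
structure Scale where
  θ : ℕ
  prime : θ.Prime
  five_le : 5 ≤ θ
  a : ℕ → ℕ
  strictMono : StrictMono a
  one_le : 1 ≤ a 0

namespace Scale

variable (S : Scale)

/-- The denominators of the lacunary series. -/
def q (k : ℕ) : ℝ := (S.θ : ℝ) ^ S.a k

theorem q_pos (k : ℕ) : 0 < S.q k := by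
  have := S.prime.pos
  unfold q; positivity

theorem five_mul_q_le (k : ℕ) : 5 * S.q k ≤ S.q (k + 1) := by
  have h1 : S.a k + 1 ≤ S.a (k + 1) := S.strictMono (Nat.lt_succ_self k)
  have h5 : (5 : ℝ) ≤ S.θ := by exact_mod_cast S.five_le
  have h2 : (S.θ : ℝ) ^ (S.a k + 1) ≤ (S.θ : ℝ) ^ S.a (k + 1) :=
    pow_le_pow_right₀ (by linarith) h1
  have := S.q_pos k
  unfold q at *
  rw [pow_succ] at h2
  nlinarith

theorem five_le_q_zero : 5 ≤ S.q 0 := by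
  have h5 : (5 : ℝ) ≤ S.θ := by exact_mod_cast S.five_le
  exact h5.trans (le_self_pow₀ (by linarith) (by have := S.one_le; omega))

theorem five_pow_mul_q_le (k m : ℕ) : 5 ^ m * S.q k ≤ S.q (k + m) := by
  induction m with
  | zero => simp
  | succ m ih =>
    have := S.five_mul_q_le (k + m)
    rw [← add_assoc, pow_succ]
    linarith

theorem inv_q_add_le (k m : ℕ) : (S.q (k + m))⁻¹ ≤ (S.q k)⁻¹ * (1 / 5) ^ m := by
  have h := S.five_pow_mul_q_le k m
  have := S.q_pos k
  calc (S.q (k + m))⁻¹ ≤ (5 ^ m * S.q k)⁻¹ := inv_anti₀ (by positivity) h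
    _ = _ := by rw [mul_inv, mul_comm, one_div, inv_pow]

theorem summable_inv_q (k : ℕ) : Summable fun m => (S.q (k + m))⁻¹ :=
  Summable.of_nonneg_of_le (fun m => inv_nonneg.2 (S.q_pos _).le) (S.inv_q_add_le k)
    ((summable_geometric_of_lt_one (by norm_num) (by norm_num)).mul_left _)

theorem tsum_inv_q_le (k : ℕ) : ∑' m, (S.q (k + m))⁻¹ ≤ 5 / 4 * (S.q k)⁻¹ := by
  have h := (summable_geometric_of_lt_one (r := (1 / 5 : ℝ)) (by norm_num)
    (by norm_num)).mul_left (S.q k)⁻¹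
  refine ((S.summable_inv_q k).tsum_le_tsum (S.inv_q_add_le k) h).trans ?_
  rw [tsum_mul_left, tsum_geometric_of_lt_one (by norm_num) (by norm_num)]
  linarith

/-- A sum of terms bounded by `2 / q (k + m)` is at most `3 / q k`. -/
theorem norm_tsum_le {F : Type*} [NormedAddCommGroup F] [CompleteSpace F] {f : ℕ → F} {k : ℕ}
    (hf : ∀ m, ‖f m‖ ≤ 2 / S.q (k + m)) : Summable f ∧ ‖∑' m, f m‖ ≤ 3 / S.q k := by
  have hs : Summable fun m => 2 / S.q (k + m) := (S.summable_inv_q k).mul_left 2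
  refine ⟨Summable.of_norm_bounded hs hf, (tsum_of_norm_bounded hs.hasSum hf).trans ?_⟩
  have h1 : ∑' m, 2 / S.q (k + m) = 2 * ∑' m, (S.q (k + m))⁻¹ := tsum_mul_left
  have h2 := S.tsum_inv_q_le k
  have h3 := inv_pos.2 (S.q_pos k)
  rw [h1, div_eq_mul_inv]
  linarith

end Scale

/-! ### The lacunary vector series and its partial sums. -/

/-- The coordinate moved by the term of index `k`. -/
def idx (r k : ℕ) : Fin (r + 2) := Fin.succ ⟨k % (r + 1), Nat.mod_lt _ r.succ_pos⟩

theorem idx_ne_zero (r k : ℕ) : idx r k ≠ 0 := Fin.succ_ne_zero _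

theorem idx_eq_iff {r k l : ℕ} : idx r k = idx r l ↔ k % (r + 1) = l % (r + 1) := by
  simp [idx]

/-- Any `r + 1` consecutive terms move distinct coordinates. -/
theorem idx_add_ne {r N i j : ℕ} (hij : i < j) (hj : j < i + (r + 1)) :
    idx r (N + i) ≠ idx r (N + j) := by
  intro h
  rw [idx_eq_iff] at h
  have h1 : (r + 1) ∣ (N + j) - (N + i) := (Nat.modEq_iff_dvd' (by omega)).1 h
  have h2 := Nat.le_of_dvd (by omega) h1
  omega

section Series

variable (S : Scale) (w : ℕ → ℕ) (r : ℕ)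

/-- The digits are `1` or `2`. -/
def IsDigits (w : ℕ → ℕ) : Prop := ∀ k, w k = 1 ∨ w k = 2

/-- The term of index `k` of the lacunary vector series. -/
def term (k : ℕ) : E (r + 2) := ((w k : ℝ) / S.q k) • EuclideanSpace.single (idx r k) 1

/-- The partial sums of the lacunary vector series. -/
def approx (N : ℕ) : E (r + 2) :=
  EuclideanSpace.single 0 1 + ∑ k ∈ Finset.range (N + 1), term S w r k

/-- The sum of the lacunary vector series. -/
def limit : E (r + 2) := EuclideanSpace.single 0 1 + ∑' k, term S w r k

theorem term_apply (k : ℕ) (i : Fin (r + 2)) :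
    term S w r k i = if idx r k = i then (w k : ℝ) / S.q k else 0 := by
  simp [term, eq_comm]

variable {S w r}

theorem one_le_digit (hw : IsDigits w) (k : ℕ) : (1 : ℝ) ≤ w k := by rcases hw k with h | h <;> simp [h]

theorem digit_le_two (hw : IsDigits w) (k : ℕ) : (w k : ℝ) ≤ 2 := by rcases hw k with h | h <;> simp [h]

theorem norm_term_le (hw : IsDigits w) (k : ℕ) : ‖term S w r k‖ ≤ 2 / S.q k := by
  have := S.q_pos k
  rw [term, norm_smul, PiLp.norm_single, norm_one, mul_one, Real.norm_eq_abs,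
    abs_of_nonneg (by positivity)]
  exact div_le_div_of_nonneg_right (digit_le_two hw k) this.le

theorem term_apply_nonneg (k : ℕ) (i : Fin (r + 2)) : 0 ≤ term S w r k i := by
  have := S.q_pos k
  rw [term_apply]
  split_ifs <;> positivity

theorem summable_term (hw : IsDigits w) : Summable (term S w r) :=
  (S.norm_tsum_le (k := 0) fun m => by rw [zero_add]; exact norm_term_le hw m).1

theorem limit_sub_approx (hw : IsDigits w) (N : ℕ) :
    limit S w r - approx S w r N = ∑' m, term S w r (N + 1 + m) := by
  have h := (summable_term (S := S) (r := r) hw).sum_add_tsum_nat_add (N + 1)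
  rw [limit, approx, ← h]
  simp only [add_comm _ (N + 1)]
  abel

theorem norm_limit_sub_approx_le (hw : IsDigits w) (N : ℕ) :
    ‖limit S w r - approx S w r N‖ ≤ 3 / S.q (N + 1) := by
  rw [limit_sub_approx hw]
  exact (S.norm_tsum_le fun m => norm_term_le hw _).2

theorem hasSum_apply {f : ℕ → E (r + 2)} {v : E (r + 2)} (h : HasSum f v) (i : Fin (r + 2)) :
    HasSum (fun k => f k i) (v i) :=
  (EuclideanSpace.proj i : E (r + 2) →L[ℝ] ℝ).hasSum h

theorem limit_apply_zero (hw : IsDigits w) : limit S w r 0 = 1 := by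
  have h := hasSum_apply (summable_term (S := S) (r := r) hw).hasSum 0
  have h0 : (fun k => term S w r k 0) = fun _ => 0 := by
    funext k
    rw [term_apply, if_neg (idx_ne_zero r k)]
  rw [h0] at h
  have := h.unique hasSum_zero
  simp [limit, this]

theorem hasSum_limit_apply_succ (hw : IsDigits w) (j : Fin (r + 1)) :
    HasSum (fun k => term S w r k j.succ) (limit S w r j.succ) := by
  have h := hasSum_apply (summable_term (S := S) (r := r) hw).hasSum j.succ
  simpa [limit] using h

theorem approx_apply_zero (N : ℕ) : approx S w r N 0 = 1 := by
  simp [approx, term_apply, idx_ne_zero]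

theorem approx_apply_of_ne (N : ℕ) {i : Fin (r + 2)} (hi : i ≠ 0) :
    approx S w r N i = ∑ k ∈ Finset.range (N + 1), term S w r k i := by
  simp [approx, hi]

theorem abs_approx_apply_le (hw : IsDigits w) (N : ℕ) (i : Fin (r + 2)) : |approx S w r N i| ≤ 1 := by
  by_cases hi : i = 0
  · rw [hi, approx_apply_zero, abs_one]
  have h0 : ∀ k, ‖term S w r k i‖ ≤ 2 / S.q (0 + k) := fun k => by
    rw [zero_add]
    exact (PiLp.norm_apply_le _ _).trans (norm_term_le hw k)
  obtain ⟨h1, h2⟩ := S.norm_tsum_le h0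
  rw [approx_apply_of_ne N hi, abs_of_nonneg
    (Finset.sum_nonneg fun k _ => term_apply_nonneg k i)]
  refine (h1.sum_le_tsum _ fun k _ => term_apply_nonneg k i).trans
    ((le_abs_self _).trans (h2.trans ?_))
  rw [div_le_one (S.q_pos 0)]
  linarith [S.five_le_q_zero]

/-- All terms are nonnegative, so nothing cancels the term of index `M`, whose digit is at least 1.
-/
theorem inv_q_le_limit_sub_approx (hw : IsDigits w) {N M : ℕ} (h : N < M) :
    (S.q M)⁻¹ ≤ limit S w r (idx r M) - approx S w r N (idx r M) := by
  have h0 : ∀ k, ‖term S w r k (idx r M)‖ ≤ 2 / S.q (0 + k) := fun k => by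
    rw [zero_add]
    exact (PiLp.norm_apply_le _ _).trans (norm_term_le hw k)
  obtain ⟨h1, -⟩ := S.norm_tsum_le h0
  have h2 := hasSum_limit_apply_succ (S := S) hw ⟨M % (r + 1), Nat.mod_lt _ r.succ_pos⟩
  have h3 : (∑ k ∈ Finset.range (N + 1), term S w r k (idx r M)) + term S w r M (idx r M) ≤
      limit S w r (idx r M) := by
    have h4 := h2.summable.sum_le_tsum (insert M (Finset.range (N + 1)))
      fun k _ => term_apply_nonneg k _
    rw [h2.tsum_eq, Finset.sum_insert (by simp; omega)] at h4
    exact (add_comm _ _).trans_le h4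
  rw [approx_apply_of_ne N (idx_ne_zero r M)]
  have h5 : (S.q M)⁻¹ ≤ term S w r M (idx r M) := by
    rw [term_apply, if_pos rfl, inv_eq_one_div]
    exact div_le_div_of_nonneg_right (one_le_digit hw M) (S.q_pos M).le
  linarith

theorem approx_add_one (N : ℕ) :
    approx S w r (N + 1) = approx S w r N +
      ((w (N + 1) : ℝ) / S.q (N + 1)) • EuclideanSpace.single (idx r (N + 1)) 1 := by
  rw [approx, Finset.sum_range_succ, ← add_assoc]
  rfl

end Series

/-! ### Subspaces spanned by consecutive partial sums: height and distance to the limit. -/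

/-- Sorting the columns changes only the sign of the minor; this allows columns to be taken in
cyclic order. -/
theorem exists_abs_plucker_eq {n e : ℕ} (X : Fin e → E n) {f : Fin e → Fin n}
    (hf : Function.Injective f) :
    ∃ s, |plucker X s| = |Matrix.det (Matrix.of fun i j : Fin e => X i (f j))| := by
  set t : Finset (Fin n) := Finset.univ.image f with ht
  have htc : t.card = e := by
    rw [ht, Finset.card_image_of_injective _ hf, Finset.card_univ, Fintype.card_fin]
  have hmem : ∀ i, ∃ k, f k = t.orderEmbOfFin htc i := fun i => by
    obtain ⟨k, -, hk⟩ := Finset.mem_image.1 (t.orderEmbOfFin_mem htc i)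
    exact ⟨k, hk⟩
  choose b hb using hmem
  have hbinj : Function.Injective b := fun i j hij => by
    apply (t.orderEmbOfFin htc).injective
    rw [← hb, ← hb, hij]
  refine ⟨t.orderEmbOfFin htc, ?_⟩
  have h := Matrix.det_permute' (Equiv.ofBijective b (Finite.injective_iff_bijective.1 hbinj))
    (Matrix.of fun i j : Fin e => X i (f j))
  have h1 : (Matrix.of fun i j : Fin e => X i (f j)).submatrix id
      (Equiv.ofBijective b (Finite.injective_iff_bijective.1 hbinj)) =
      Matrix.of fun i j : Fin e => X i (t.orderEmbOfFin htc j) := by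
    ext i j
    simp [← hb]
  rw [h1] at h
  rw [plucker, h, abs_mul]
  rcases Int.units_eq_one_or (Equiv.Perm.sign
    (Equiv.ofBijective b (Finite.injective_iff_bijective.1 hbinj))) with h2 | h2 <;> simp [h2]

theorem plucker_cons_smul {n e : ℕ} (c : ℝ) (y : E n) (X : Fin e → E n)
    (s : Fin (e + 1) ↪o Fin n) :
    plucker (Fin.cons (c • y) X : Fin (e + 1) → E n) s =
      c * plucker (Fin.cons y X : Fin (e + 1) → E n) s := by
  simp only [plucker_cons, wedgeCoord, Finset.mul_sum]
  exact Finset.sum_congr rfl fun j _ => by simp; ring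

section ApproxSpan

variable (S : Scale) (w : ℕ → ℕ) (r : ℕ)

/-- The integer vector proportional to `approx S w r N`, followed by the basis vectors of indices
`N + 1, …, N + m`. -/
def approxBasis (N m : ℕ) : Fin (m + 1) → E (r + 2) :=
  Fin.cons (S.q N • approx S w r N)
    fun i : Fin m => EuclideanSpace.single (idx r (N + (i + 1))) 1

/-- The subspace spanned by the approximations of indices `N, …, N + m`. -/
def approxSpan (N m : ℕ) : Submodule ℝ (E (r + 2)) :=
  Submodule.span ℝ (Set.range (approxBasis S w r N m))

variable {S w r}

theorem approx_mem_approxSpan (N : ℕ) {m i : ℕ} (hi : i ≤ m) :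
    approx S w r (N + i) ∈ approxSpan S w r N m := by
  induction i with
  | zero =>
    have h : S.q N • approx S w r N ∈ approxSpan S w r N m :=
      Submodule.subset_span ⟨0, rfl⟩
    have h2 := Submodule.smul_mem _ (S.q N)⁻¹ h
    rwa [inv_smul_smul₀ (S.q_pos N).ne'] at h2
  | succ i ih =>
    rw [← add_assoc, approx_add_one]
    refine Submodule.add_mem _ (ih (by omega)) (Submodule.smul_mem _ _ ?_)
    exact Submodule.subset_span ⟨Fin.succ ⟨i, by omega⟩, by rw [approxBasis, Fin.cons_succ, add_assoc]⟩

/-- Digits never vanish, so differences of consecutive partial sums recover the basis vectors. -/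
theorem approxSpan_le (hw : IsDigits w) {N m : ℕ} {B : Submodule ℝ (E (r + 2))}
    (h : ∀ i ≤ m, approx S w r (N + i) ∈ B) : approxSpan S w r N m ≤ B := by
  refine Submodule.span_le.2 ?_
  rintro _ ⟨i, rfl⟩
  refine Fin.cases ?_ (fun i => ?_) i
  · exact B.smul_mem _ (h 0 (Nat.zero_le _))
  · have h1 := h i (by omega)
    have h2 := h (i + 1) (by omega)
    rw [← add_assoc, approx_add_one, B.add_mem_iff_right h1] at h2
    have hne : (w (N + i + 1) : ℝ) / S.q (N + i + 1) ≠ 0 :=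
      div_ne_zero (by linarith [one_le_digit hw (N + i + 1)]) (S.q_pos _).ne'
    exact (B.smul_mem_iff hne).1 h2

theorem approxBasis_integral (N m : ℕ) (i : Fin (m + 1)) (j : Fin (r + 2)) :
    ∃ z : ℤ, approxBasis S w r N m i j = z := by
  refine Fin.cases ?_ (fun i => ?_) i
  · by_cases hj : j = 0
    · exact ⟨S.θ ^ S.a N, by simp [approxBasis, hj, approx_apply_zero, Scale.q]⟩
    · refine ⟨∑ k ∈ Finset.range (N + 1),
        if idx r k = j then w k * (S.θ : ℤ) ^ (S.a N - S.a k) else 0, ?_⟩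
      simp only [approxBasis, Fin.cons_zero, PiLp.smul_apply, smul_eq_mul,
        approx_apply_of_ne N hj, Finset.mul_sum, term_apply]
      push_cast
      refine Finset.sum_congr rfl fun k hk => ?_
      have hle : S.a k ≤ S.a N := S.strictMono.monotone (by simp at hk; omega)
      have hθ : (S.θ : ℝ) ≠ 0 := by exact_mod_cast S.prime.ne_zero
      split_ifs
      · rw [Scale.q, Scale.q, pow_sub₀ _ hθ hle]
        ring
      · simp
  · by_cases hj : j = idx r (N + (i + 1))
    · exact ⟨1, by simp [approxBasis, hj]⟩
    · exact ⟨0, by simp [approxBasis, hj]⟩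

theorem smul_approx_integral (N : ℕ) (j : Fin (r + 2)) :
    ∃ z : ℤ, (S.q N • approx S w r N) j = z :=
  approxBasis_integral (S := S) (w := w) (r := r) N 0 0 j

/-- The coordinate moved by the last term is coprime to the denominator. -/
theorem exists_smul_approx_idx (hw : IsDigits w) (N : ℕ) :
    ∃ z : ℤ, (S.q N • approx S w r N) (idx r N) = z ∧ IsCoprime z ((S.θ : ℤ) ^ S.a N) := by
  have hθ : (S.θ : ℝ) ≠ 0 := by exact_mod_cast S.prime.ne_zero
  refine ⟨(∑ k ∈ Finset.range N, if idx r k = idx r N then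
    w k * (S.θ : ℤ) ^ (S.a N - S.a k) else 0) + w N, ?_, ?_⟩
  · simp only [PiLp.smul_apply, smul_eq_mul, approx_apply_of_ne N (idx_ne_zero r N),
      Finset.mul_sum, term_apply]
    rw [Finset.sum_range_succ, if_pos rfl, mul_div_cancel₀ _ (S.q_pos N).ne']
    push_cast
    congr 1
    refine Finset.sum_congr rfl fun k hk => ?_
    have hle : S.a k ≤ S.a N := S.strictMono.monotone (by simp at hk; omega)
    split_ifs
    · rw [Scale.q, Scale.q, pow_sub₀ _ hθ hle]
      ring
    · simp
  -- Modulo `θ` only the last digit survives, and 1 and 2 are prime to `θ ≥ 5`.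
  · refine IsCoprime.pow_right ?_
    have hdvd : (S.θ : ℤ) ∣ ∑ k ∈ Finset.range N, if idx r k = idx r N then
        w k * (S.θ : ℤ) ^ (S.a N - S.a k) else 0 := by
      refine Finset.dvd_sum fun k hk => ?_
      have hlt : S.a k < S.a N := S.strictMono (by simpa using hk)
      split_ifs
      · exact Dvd.dvd.mul_left (dvd_pow_self _ (by omega)) _
      · exact dvd_zero _
    obtain ⟨c, hc⟩ := hdvd
    rw [hc, IsCoprime.mul_add_left_left_iff, Nat.isCoprime_iff_coprime]
    refine Nat.Coprime.symm ((Nat.Prime.coprime_iff_not_dvd S.prime).2 fun h => ?_)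
    have h1 := S.five_le
    rcases hw N with h2 | h2 <;> rw [h2] at h <;> have := Nat.le_of_dvd (by norm_num) h <;> omega

/-- On the columns `c, idx (N+1), …, idx (N+m)` the matrix is upper triangular, with 1 on the
diagonal after the first entry. -/
theorem exists_abs_plucker_approxBasis {N m : ℕ} (hm : m ≤ r) (c : Fin (r + 2))
    (hc : ∀ i < m, c ≠ idx r (N + (i + 1))) :
    ∃ s, |plucker (approxBasis S w r N m) s| = |(S.q N • approx S w r N) c| := by
  set f : Fin (m + 1) → Fin (r + 2) := Fin.cons c fun i : Fin m => idx r (N + (i + 1)) with hf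
  have hidx : ∀ i j : Fin m, idx r (N + (i + 1)) = idx r (N + (j + 1)) → i = j := by
    intro i j hij
    rcases lt_trichotomy i j with h | h | h
    · exact absurd hij (idx_add_ne (by simpa using h) (by omega))
    · exact h
    · exact absurd hij.symm (idx_add_ne (by simpa using h) (by omega))
  have hinj : Function.Injective f := by
    rw [hf, Fin.cons_injective_iff]
    refine ⟨?_, fun i j h => hidx i j h⟩
    rintro ⟨i, hi⟩
    exact hc i i.2 hi.symm
  obtain ⟨s, hs⟩ := exists_abs_plucker_eq (approxBasis S w r N m) hinj
  refine ⟨s, hs.trans ?_⟩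
  rw [Matrix.det_of_isUpperTriangular]
  · rw [Fin.prod_univ_succ]
    simp [approxBasis, hf]
  · intro i j hij
    obtain ⟨i, rfl⟩ := Fin.exists_succ_eq.2 (Fin.ne_zero_of_lt hij)
    revert hij
    refine Fin.cases (fun _ => ?_) (fun j hij => ?_) j
    · simp [approxBasis, hf, hc i i.2]
    · have hne : idx r (N + (j + 1)) ≠ idx r (N + (i + 1)) := fun h =>
        absurd (hidx j i h) (Fin.succ_lt_succ_iff.1 hij).ne
      simp [approxBasis, hf, hne]

theorem exists_plucker_approxBasis_zero {N m : ℕ} (hm : m ≤ r) :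
    ∃ s, |plucker (approxBasis S w r N m) s| = S.q N := by
  obtain ⟨s, hs⟩ := exists_abs_plucker_approxBasis (S := S) (w := w) (N := N) hm 0
    fun i _ => (idx_ne_zero r _).symm
  refine ⟨s, hs.trans ?_⟩
  simp [approx_apply_zero, abs_of_pos (S.q_pos N)]

theorem approxBasis_linearIndependent {N m : ℕ} (hm : m ≤ r) :
    LinearIndependent ℝ (approxBasis S w r N m) := by
  obtain ⟨s, hs⟩ := exists_plucker_approxBasis_zero (S := S) (w := w) (N := N) hm
  refine linearIndependent_of_plucker_ne_zero (s := s) fun h => ?_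
  rw [h, abs_zero] at hs
  exact (S.q_pos N).ne hs

theorem approxSpan_mem_rationalSubspaces {N m : ℕ} (hm : m ≤ r) :
    approxSpan S w r N m ∈ rationalSubspaces (r + 2) (m + 1) := by
  refine ⟨approxBasis S w r N m, approxBasis_linearIndependent hm, rfl, fun i j => ?_⟩
  obtain ⟨z, hz⟩ := approxBasis_integral (S := S) (w := w) (r := r) N m i j
  exact ⟨z, by simp [hz]⟩

/-- Integer Grassmann coordinates of `approxSpan S w r N m`: one of them is `± q N` and another
one is coprime to `q N`. -/
theorem exists_int_plucker (hw : IsDigits w) {N m : ℕ} (hm : m ≤ r) :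
    ∃ ζ : (Fin (m + 1) ↪o Fin (r + 2)) → ℤ,
      (∀ s, plucker (approxBasis S w r N m) s = ζ s) ∧
      ∃ s₀ s₁, |ζ s₀| = (S.θ : ℤ) ^ S.a N ∧ IsCoprime (ζ s₁) ((S.θ : ℤ) ^ S.a N) := by
  choose Z hZ using fun i j => approxBasis_integral (S := S) (w := w) (r := r) N m i j
  have hζ : ∀ s, plucker (approxBasis S w r N m) s =
      ((Matrix.det (Matrix.of fun i j => Z i (s j)) : ℤ) : ℝ) := fun s => by
    have := RingHom.map_det (Int.castRingHom ℝ) (Matrix.of fun i j => Z i (s j))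
    simp only [eq_intCast] at this
    rw [this, plucker]
    congr 1
    ext i j
    simp [hZ]
  refine ⟨_, hζ, ?_⟩
  obtain ⟨s₀, h₀⟩ := exists_plucker_approxBasis_zero (S := S) (w := w) (N := N) hm
  obtain ⟨s₁, h₁⟩ := exists_abs_plucker_approxBasis (S := S) (w := w) (N := N) hm (idx r N)
    fun i hi => idx_add_ne (i := 0) (by omega) (by omega)
  obtain ⟨z, hz, hcop⟩ := exists_smul_approx_idx (S := S) (r := r) hw N
  refine ⟨s₀, s₁, ?_, ?_⟩
  · rw [hζ, Scale.q] at h₀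
    exact_mod_cast h₀
  · rw [hζ, hz] at h₁
    have h2 : |Matrix.det (Matrix.of fun i j => Z i (s₁ j))| = |z| := by
      rw [← Int.cast_abs, ← Int.cast_abs] at h₁
      exact Int.cast_injective h₁
    rcases abs_eq_abs.1 h2 with h | h <;> rw [h]
    · exact hcop
    · exact hcop.neg_left

/-- Any primitive representative `η` is proportional to `ζ`; since `ζ s₁` is prime to `q N = |ζ
s₀|`, the cross relation forces `q N` to divide `η s₀`. -/
theorem q_le_height (hw : IsDigits w) {N m : ℕ} (hm : m ≤ r) :
    S.q N ≤ height (m + 1) (approxSpan S w r N m) := by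
  refine le_height (approxSpan_mem_rationalSubspaces hm) fun η hη => ?_
  obtain ⟨ζ, hζ, s₀, s₁, h₀, h₁⟩ := exists_int_plucker (S := S) (N := N) hw hm
  obtain ⟨⟨X, hX, hspan, c, hc, hcη⟩, -⟩ := hη
  obtain ⟨d, hd⟩ := exists_plucker_eq_mul (X := X) (X' := approxBasis S w r N m) fun i => by
    rw [hspan]; exact Submodule.subset_span ⟨i, rfl⟩
  have hζη : ∀ s, c * (ζ s : ℝ) = d * η s := fun s => by
    rw [← hζ, hd, hcη]; ring
  have hζ₀ : (ζ s₀ : ℝ) ≠ 0 := by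
    have h : ζ s₀ ≠ 0 := by
      rw [← abs_pos, h₀]; have := S.prime.pos; positivity
    exact_mod_cast h
  have hd0 : d ≠ 0 := by
    rintro rfl
    have := hζη s₀
    rw [zero_mul] at this
    exact mul_ne_zero hc hζ₀ this
  have hη₀ : (η s₀ : ℝ) ≠ 0 := fun h => by
    have := hζη s₀
    rw [h, mul_zero] at this
    exact mul_ne_zero hc hζ₀ this
  have hcross : η s₀ * ζ s₁ = ζ s₀ * η s₁ := by
    have : (η s₀ * ζ s₁ : ℝ) = ζ s₀ * η s₁ := by
      apply mul_left_cancel₀ (mul_ne_zero hc hd0)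
      linear_combination (d * η s₀) * hζη s₁ - (d * η s₁) * hζη s₀
    exact_mod_cast this
  have hdvd : (S.θ : ℤ) ^ S.a N ∣ η s₀ := by
    refine h₁.symm.dvd_of_dvd_mul_right ?_
    rw [hcross, ← h₀]
    exact Dvd.dvd.mul_right ((abs_dvd _ _).2 dvd_rfl) _
  refine le_trans ?_ (abs_le_sqrt_sum (fun s => (η s : ℝ)) s₀)
  have h1 : (S.θ : ℤ) ^ S.a N ≤ |η s₀| :=
    Int.le_of_dvd (abs_pos.2 (by exact_mod_cast hη₀)) ((dvd_abs _ _).2 hdvd)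
  rw [Scale.q]
  exact_mod_cast h1

theorem abs_plucker_le {n e : ℕ} {X : Fin e → E n} (hX : ∀ i j, |X i j| ≤ 1)
    (s : Fin e ↪o Fin n) : |plucker X s| ≤ e.factorial := by
  have h := Matrix.det_le (A := Matrix.of fun i j : Fin e => X i (s j))
    (abv := AbsoluteValue.abs) (x := (1 : ℝ)) fun i j => by simpa using hX i (s j)
  simpa [plucker] using h

/-- The factor `q N` comes out of the first row of each minor, leaving entries of absolute value at
most 1. -/
theorem height_approxSpan_le (hw : IsDigits w) {N m : ℕ} (hm : m ≤ r) :
    height (m + 1) (approxSpan S w r N m) ≤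
      (Fintype.card (Fin (m + 1) ↪o Fin (r + 2)) * (m + 1).factorial : ℝ) * S.q N := by
  obtain ⟨ζ, hζ, s₀, s₁, h₀, h₁⟩ := exists_int_plucker (S := S) (N := N) hw hm
  have hprim : IsPrimitivePlucker (approxSpan S w r N m) ζ := by
    refine ⟨⟨approxBasis S w r N m, approxBasis_linearIndependent hm, rfl, 1, one_ne_zero,
      fun s => by rw [hζ, one_mul]⟩, fun d hd => ?_⟩
    refine h₁.isUnit_of_dvd' (hd s₁) ?_
    rw [← h₀]
    exact (dvd_abs _ _).2 (hd s₀)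
  refine (height_le hprim).trans ?_
  have hb : ∀ s, |(ζ s : ℝ)| ≤ (m + 1).factorial * S.q N := fun s => by
    rw [← hζ, approxBasis, plucker_cons_smul, abs_mul, abs_of_pos (S.q_pos N), mul_comm]
    have := S.q_pos N
    gcongr
    refine abs_plucker_le (fun i j => ?_) s
    refine Fin.cases ?_ (fun i => ?_) i
    · exact abs_approx_apply_le hw N j
    · by_cases hj : j = idx r (N + (i + 1)) <;> simp [hj]
  calc Real.sqrt (∑ s, (ζ s : ℝ) ^ 2) ≤ ∑ s, |(ζ s : ℝ)| := by
        refine Real.sqrt_le_iff.2 ⟨Finset.sum_nonneg fun _ _ => abs_nonneg _, ?_⟩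
        simp only [← sq_abs (ζ _ : ℝ)]
        exact Finset.sum_sq_le_sq_sum_of_nonneg fun _ _ => abs_nonneg _
    _ ≤ ∑ _s : Fin (m + 1) ↪o Fin (r + 2), ((m + 1).factorial * S.q N : ℝ) :=
        Finset.sum_le_sum fun s _ => hb s
    _ = _ := by simp; ring

/-- Let `J` be the coordinate moved next after the span. The form `b ↦ approx N J * b 0 - b J`
vanishes on the span, has coefficients at most 1 in absolute value, and is at least `1 / q (N + m +
1)` in absolute value at the limit. -/
theorem inv_q_le_norm_limit_sub (hw : IsDigits w) {N m : ℕ} (hm : m ≤ r) {b : E (r + 2)}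
    (hb : b ∈ approxSpan S w r N m) :
    (S.q (N + (m + 1)))⁻¹ ≤ 2 * ‖limit S w r - b‖ := by
  set J := idx r (N + (m + 1)) with hJ
  have hf : approx S w r N J * b 0 - b J = 0 := by
    refine Submodule.span_induction (p := fun b _ => approx S w r N J * b 0 - b J = 0)
      ?_ (by simp) ?_ ?_ hb
    · rintro _ ⟨i, rfl⟩
      refine Fin.cases ?_ (fun i => ?_) i
      · simp [approxBasis, approx_apply_zero]; ring
      · have h : idx r (N + (i + 1)) ≠ J := idx_add_ne (by omega) (by omega)
        simp [approxBasis, (idx_ne_zero r _).symm, h.symm]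
    · intro x y _ _ hx hy
      simp only [PiLp.add_apply]
      linear_combination hx + hy
    · intro c x _ hx
      simp only [PiLp.smul_apply, smul_eq_mul]
      linear_combination c * hx
  have h1 := inv_q_le_limit_sub_approx (S := S) (r := r) hw (show N < N + (m + 1) by omega)
  rw [← hJ] at h1
  have h2 : limit S w r J - approx S w r N J =
      (limit S w r - b) J - approx S w r N J * (limit S w r - b) 0 := by
    simp only [PiLp.sub_apply, limit_apply_zero hw]
    linear_combination -hf
  have h3 : |approx S w r N J * (limit S w r - b) 0| ≤ 1 * ‖limit S w r - b‖ := by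
    rw [abs_mul]
    exact mul_le_mul (abs_approx_apply_le hw N J) (PiLp.norm_apply_le (limit S w r - b) 0) (abs_nonneg _)
      zero_le_one
  have h4 : |(limit S w r - b) J| ≤ ‖limit S w r - b‖ :=
    PiLp.norm_apply_le (limit S w r - b) J
  have := (abs_le.1 h3).1
  have := (abs_le.1 h4).2
  linarith

theorem one_le_norm_limit (hw : IsDigits w) : 1 ≤ ‖limit S w r‖ := by
  have := PiLp.norm_apply_le (limit S w r) 0
  rwa [limit_apply_zero hw, norm_one] at this

theorem limit_ne_zero (hw : IsDigits w) : limit S w r ≠ 0 :=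
  norm_pos_iff.1 (zero_lt_one.trans_le (one_le_norm_limit hw))

end ApproxSpan

/-! ### Growth of the exponents and the golden ratio. -/

section Growth

variable {γ : ℕ → ℝ}

theorem alpha_succ (γ : ℕ → ℝ) (k : ℕ) : alpha γ (k + 1) = γ (k + 1) * alpha γ k := rfl

theorem alpha_add (γ : ℕ → ℝ) (N e : ℕ) :
    alpha γ (N + e) = (∏ l ∈ Finset.Icc 1 e, γ (N + l)) * alpha γ N := by
  induction e with
  | zero => simp
  | succ e ih =>
    rw [← add_assoc, alpha_succ, ih, Finset.prod_Icc_succ_top (by omega), ← add_assoc]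
    ring

theorem two_lt_golden : (2 : ℝ) < 2 + (Real.sqrt 5 - 1) / 2 := by
  have : (1 : ℝ) < Real.sqrt 5 := Real.lt_sqrt_of_sq_lt (by norm_num)
  linarith

/-- The threshold is the larger root of `g² - 3g + 1`. -/
theorem sub_one_le_mul {g : ℝ} (hg : 2 + (Real.sqrt 5 - 1) / 2 ≤ g) : g - 1 ≤ g * (g - 2) := by
  have h1 := Real.sq_sqrt (show (0 : ℝ) ≤ 5 by norm_num)
  have h2 := two_lt_golden
  nlinarith

theorem one_le_alpha (hγ : ∀ k, 1 ≤ k → 2 + (Real.sqrt 5 - 1) / 2 ≤ γ k) (k : ℕ) :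
    1 ≤ alpha γ k := by
  induction k with
  | zero => exact le_rfl
  | succ k ih =>
    rw [alpha_succ]
    have := hγ (k + 1) (by omega)
    have := two_lt_golden
    nlinarith

theorem two_mul_alpha_le (hγ : ∀ k, 1 ≤ k → 2 + (Real.sqrt 5 - 1) / 2 ≤ γ k) (k : ℕ) :
    2 * alpha γ k ≤ alpha γ (k + 1) := by
  rw [alpha_succ]
  have := hγ (k + 1) (by omega)
  have := two_lt_golden
  have := one_le_alpha hγ k
  nlinarith

theorem alpha_monotone (hγ : ∀ k, 1 ≤ k → 2 + (Real.sqrt 5 - 1) / 2 ≤ γ k) :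
    Monotone (alpha γ) :=
  monotone_nat_of_le_succ fun k => by linarith [two_mul_alpha_le hγ k, one_le_alpha hγ k]

theorem succ_le_alpha (hγ : ∀ k, 1 ≤ k → 2 + (Real.sqrt 5 - 1) / 2 ≤ γ k) (k : ℕ) :
    (k + 1 : ℝ) ≤ alpha γ k := by
  induction k with
  | zero => simp [alpha]
  | succ k ih =>
    have := two_mul_alpha_le hγ k
    have := one_le_alpha hγ k
    push_cast
    linarith

theorem alpha_gap_monotone (hγ : ∀ k, 1 ≤ k → 2 + (Real.sqrt 5 - 1) / 2 ≤ γ k) :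
    Monotone fun k => alpha γ (k + 1) - alpha γ k :=
  monotone_nat_of_le_succ fun k => by
    have := two_mul_alpha_le hγ (k + 1)
    have := one_le_alpha hγ k
    linarith

/-- This is where the golden ratio enters. -/
theorem alpha_add_le_mul_gap (hγ : ∀ k, 1 ≤ k → 2 + (Real.sqrt 5 - 1) / 2 ≤ γ k) {P : ℝ}
    {M m : ℕ} (hP : alpha γ (M + (m + 1)) ≤ P * alpha γ M) :
    alpha γ (M + (m + 1)) ≤ (P - 1) * (alpha γ (M + 1) - alpha γ M) := by
  have hα := one_le_alpha hγ M
  have hg := hγ (M + 1) (by omega)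
  have hmono : alpha γ (M + 1) ≤ alpha γ (M + (m + 1)) := alpha_monotone hγ (by omega)
  obtain ⟨p, hp⟩ : ∃ p, alpha γ (M + (m + 1)) = p * alpha γ M := ⟨_, alpha_add γ M (m + 1)⟩
  rw [hp] at hP hmono ⊢
  rw [alpha_succ] at hmono ⊢
  have hpP : p ≤ P := le_of_mul_le_mul_right hP (by linarith)
  have hgp : γ (M + 1) ≤ p := le_of_mul_le_mul_right hmono (by linarith)
  have h2 := two_lt_golden
  have h3 := sub_one_le_mul hg
  -- With `g = γ (M + 1)`, the inequality `p ≤ (p - 1)(g - 1)` amounts to `g - 1 ≤ p (g - 2)`, which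
  -- follows from the case `p = g`.
  have h4 : p ≤ (P - 1) * (γ (M + 1) - 1) := by nlinarith
  calc p * alpha γ M ≤ ((P - 1) * (γ (M + 1) - 1)) * alpha γ M := by gcongr
    _ = _ := by ring

/-- The scale of exponents `⌊α_k⌋`. -/
def alphaScale (θ : ℕ) (hθ : θ.Prime) (hθ5 : 5 ≤ θ)
    (hγ : ∀ k, 1 ≤ k → 2 + (Real.sqrt 5 - 1) / 2 ≤ γ k) : Scale where
  θ := θ
  prime := hθ
  five_le := hθ5
  a k := ⌊alpha γ k⌋₊
  strictMono := strictMono_nat_of_lt_succ fun k => by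
    have h1 := one_le_alpha hγ k
    rw [Nat.lt_iff_add_one_le, ← Nat.floor_add_one (by linarith)]
    exact Nat.floor_mono (by linarith [two_mul_alpha_le hγ k])
  one_le := by simp [alpha]

/-- The exponents of `S` are the integral parts of the `α_k`. -/
def Scale.IsFloor (S : Scale) (γ : ℕ → ℝ) : Prop := ∀ k, S.a k = ⌊alpha γ k⌋₊

end Growth

/-! ### Lower and upper bounds for the exponent. -/

section Bounds

variable {S : Scale} {γ : ℕ → ℝ} {w : ℕ → ℕ} {r : ℕ}

theorem Scale.one_lt_base (S : Scale) : (1 : ℝ) < S.θ := by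
  have : (5 : ℝ) ≤ S.θ := by exact_mod_cast S.five_le
  linarith

theorem Scale.q_le (hS : S.IsFloor γ) (hγ : ∀ k, 1 ≤ k → 2 + (Real.sqrt 5 - 1) / 2 ≤ γ k)
    (k : ℕ) : S.q k ≤ (S.θ : ℝ) ^ alpha γ k := by
  rw [Scale.q, ← Real.rpow_natCast]
  refine Real.rpow_le_rpow_of_exponent_le S.one_lt_base.le ?_
  rw [hS k]
  exact Nat.floor_le (by linarith [one_le_alpha hγ k])

theorem Scale.le_q (hS : S.IsFloor γ) (k : ℕ) : (S.θ : ℝ) ^ (alpha γ k - 1) ≤ S.q k := by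
  rw [Scale.q, ← Real.rpow_natCast]
  refine Real.rpow_le_rpow_of_exponent_le S.one_lt_base.le ?_
  rw [hS k]
  linarith [Nat.lt_floor_add_one (alpha γ k)]

theorem omegaMin_nonneg {n : ℕ} (A B : Submodule ℝ (E n)) : 0 ≤ omegaMin A B :=
  Real.sInf_nonneg (by rintro _ ⟨X, -, Y, -, -, -, rfl⟩; exact omega_nonneg X Y)

theorem omegaMin_approxSpan_le (hw : IsDigits w) (N m : ℕ) :
    omegaMin (Submodule.span ℝ {limit S w r}) (approxSpan S w r N m) ≤
      3 / S.q (N + (m + 1)) := by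
  have hb0 : approx S w r (N + m) ≠ 0 := fun h => by
    have := approx_apply_zero (S := S) (w := w) (r := r) (N + m)
    rw [h] at this
    simp at this
  have h1 := omegaMin_mul_norm_le (limit_ne_zero (S := S) (r := r) hw)
    (approx_mem_approxSpan (S := S) (w := w) (r := r) N (le_refl m)) hb0
  have h2 := norm_limit_sub_approx_le (S := S) (r := r) hw (N + m)
  have h3 := le_mul_of_one_le_right (omegaMin_nonneg (Submodule.span ℝ {limit S w r})
    (approxSpan S w r N m)) (one_le_norm_limit (S := S) (r := r) hw)
  rw [add_assoc] at h2
  linarith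

theorem infinite_of_lt (hS : S.IsFloor γ)
    (hγ : ∀ k, 1 ≤ k → 2 + (Real.sqrt 5 - 1) / 2 ≤ γ k) (hw : IsDigits w) {m : ℕ} (hm : m ≤ r)
    {P μ : ℝ} (hμ0 : 0 < μ) (hμ : μ < P)
    (hP : ∀ K : ℕ, ∃ N ≥ K, alpha γ (N + (m + 1)) = P * alpha γ N) :
    {B : Submodule ℝ (E (r + 2)) | B ∈ rationalSubspaces (r + 2) (m + 1) ∧
      psi 1 (Submodule.span ℝ {limit S w r}) B ≤ height (m + 1) B ^ (-μ)}.Infinite := by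
  intro hfin
  obtain ⟨M, hM⟩ := (hfin.image (height (m + 1))).bddAbove
  set C : ℝ := Fintype.card (Fin (m + 1) ↪o Fin (r + 2)) * (m + 1).factorial with hC
  have ht := S.one_lt_base
  have ht0 : (0 : ℝ) < S.θ := by linarith
  obtain ⟨K₁, hK₁⟩ := exists_nat_gt M
  -- `θ ^ L` absorbs the constants. For `N ≥ K₂` one has `L + μ α_N ≤ P α_N - 1`, the 1 being the
  -- loss from the integral part.
  set L : ℝ := Real.logb S.θ (3 * (C + 1) ^ μ) with hL
  obtain ⟨K₂, hK₂⟩ := exists_nat_gt ((L + 1) / (P - μ))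
  obtain ⟨N, hN, hPN⟩ := hP (max K₁ K₂)
  have hC0 : 0 ≤ C := by positivity
  have hα : (L + 1) / (P - μ) ≤ alpha γ N := by
    have h1 : (K₂ : ℝ) ≤ N := by exact_mod_cast (le_max_right _ _).trans hN
    linarith [succ_le_alpha hγ N]
  rw [div_le_iff₀ (by linarith)] at hα
  have hH1 := one_le_height (approxSpan_mem_rationalSubspaces (S := S) (w := w) (N := N) hm)
  have hH2 := height_approxSpan_le (S := S) (N := N) hw hm
  have hqN := S.q_pos N
  have hmem : approxSpan S w r N m ∈ {B : Submodule ℝ (E (r + 2)) |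
      B ∈ rationalSubspaces (r + 2) (m + 1) ∧
      psi 1 (Submodule.span ℝ {limit S w r}) B ≤ height (m + 1) B ^ (-μ)} := by
    refine ⟨approxSpan_mem_rationalSubspaces hm, ?_⟩
    rw [psi_one_span_singleton (limit_ne_zero hw) (approxSpan_mem_rationalSubspaces hm)
      (by omega)]
    refine (omegaMin_approxSpan_le hw N m).trans ?_
    rw [Real.rpow_neg (by linarith), div_le_iff₀ (S.q_pos _), inv_mul_eq_div,
      le_div_iff₀ (by positivity)]
    have h1 : height (m + 1) (approxSpan S w r N m) ^ μ ≤ (C + 1) ^ μ * S.q N ^ μ := by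
      rw [← Real.mul_rpow (by positivity) hqN.le]
      refine Real.rpow_le_rpow (by linarith) (hH2.trans ?_) hμ0.le
      rw [← hC]
      nlinarith
    have h2 : S.q N ^ μ ≤ (S.θ : ℝ) ^ (alpha γ N * μ) := by
      rw [Real.rpow_mul ht0.le]
      exact Real.rpow_le_rpow hqN.le (Scale.q_le hS hγ N) hμ0.le
    have h3 : 3 * (C + 1) ^ μ = (S.θ : ℝ) ^ L :=
      (Real.rpow_logb ht0 ht.ne' (by positivity)).symm
    calc 3 * height (m + 1) (approxSpan S w r N m) ^ μ
        ≤ 3 * ((C + 1) ^ μ * (S.θ : ℝ) ^ (alpha γ N * μ)) := by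
          gcongr
          exact h1.trans (by gcongr)
      _ = (S.θ : ℝ) ^ (L + alpha γ N * μ) := by rw [← mul_assoc, h3, Real.rpow_add ht0]
      _ ≤ (S.θ : ℝ) ^ (alpha γ (N + (m + 1)) - 1) := by
          refine Real.rpow_le_rpow_of_exponent_le ht.le ?_
          rw [hPN]; linarith
      _ ≤ _ := Scale.le_q hS _
  have h1 := hM ⟨_, hmem, rfl⟩
  have h2 := q_le_height (S := S) (N := N) hw hm
  have h3 : (N : ℝ) ≤ S.q N := by
    have h4 := S.five_pow_mul_q_le 0 N
    have h5 : (N : ℝ) < 5 ^ N := by exact_mod_cast Nat.lt_pow_self (by norm_num)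
    rw [zero_add] at h4
    nlinarith [S.five_le_q_zero]
  have h4 : (K₁ : ℝ) ≤ N := by exact_mod_cast (le_max_left _ _).trans hN
  linarith

/-- A rational subspace which is close to the limit and not too high contains the
approximations. -/
theorem approx_mem_of_omegaMin_le (hw : IsDigits w) {e : ℕ} (he : 1 ≤ e)
    {B : Submodule ℝ (E (r + 2))} (hB : B ∈ rationalSubspaces (r + 2) e) {δ : ℝ}
    (hδ : omegaMin (Submodule.span ℝ {limit S w r}) B ≤ δ) {k : ℕ}
    (h1 : 6 * height e B * S.q k ≤ S.q (k + 1))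
    (h2 : 2 * ‖limit S w r‖ * δ * height e B * S.q k < 1) : approx S w r k ∈ B := by
  by_contra hx
  have hq := S.q_pos k
  have hq' := S.q_pos (k + 1)
  have hH : 0 < height e B := zero_lt_one.trans_le (one_le_height hB)
  have hX : S.q k • approx S w r k ∉ B := fun h => hx ((B.smul_mem_iff hq.ne').1 h)
  -- The Liouville bound for `q k • approx k`, less the truncation error. By `h1` that error costs
  -- at most half of the bound; by `h2` what remains exceeds the assumed closeness.
  have h3 : ∀ b ∈ B, 1 / (height e B * S.q k) - 3 / S.q (k + 1) ≤ ‖limit S w r - b‖ := by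
    intro b hb
    have h4 := one_le_height_mul_norm_sub hB (smul_approx_integral k) hX (B.smul_mem (S.q k) hb)
    rw [← smul_sub, norm_smul, Real.norm_eq_abs, abs_of_pos hq, ← mul_assoc] at h4
    have h5 : 1 / (height e B * S.q k) ≤ ‖approx S w r k - b‖ := by
      rw [div_le_iff₀ (by positivity)]; linarith
    have h6 := norm_limit_sub_approx_le (S := S) (r := r) hw k
    have h7 : ‖approx S w r k - b‖ ≤
        ‖limit S w r - b‖ + ‖limit S w r - approx S w r k‖ := by
      have : approx S w r k - b =
        (limit S w r - b) - (limit S w r - approx S w r k) := by abel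
      rw [this]; exact norm_sub_le _ _
    linarith
  have h4 := le_omegaMin_mul_norm (limit_ne_zero (S := S) (r := r) hw)
    (ne_bot_of_mem_rationalSubspaces he hB) h3
  have h5 : omegaMin (Submodule.span ℝ {limit S w r}) B * ‖limit S w r‖ ≤
      δ * ‖limit S w r‖ := by gcongr
  have h6 : 3 / S.q (k + 1) ≤ 1 / 2 * (1 / (height e B * S.q k)) := by
    rw [div_mul_div_comm, div_le_div_iff₀ hq' (by positivity)]
    linarith
  have h7 : δ * ‖limit S w r‖ < 1 / 2 * (1 / (height e B * S.q k)) := by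
    rw [div_mul_div_comm, lt_div_iff₀ (by positivity)]
    linarith
  linarith

/-- Beyond a certain height, an approximating subspace must be one of the spans of partial sums, and
those have exponent at most `P` asymptotically. -/
theorem finite_of_lt (hS : S.IsFloor γ)
    (hγ : ∀ k, 1 ≤ k → 2 + (Real.sqrt 5 - 1) / 2 ≤ γ k) (hw : IsDigits w) {m : ℕ} (hm : m ≤ r)
    {P μ : ℝ} (hμ : P < μ) (hP : ∀ N, alpha γ (N + (m + 1)) ≤ P * alpha γ N) :
    {B : Submodule ℝ (E (r + 2)) | B ∈ rationalSubspaces (r + 2) (m + 1) ∧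
      psi 1 (Submodule.span ℝ {limit S w r}) B ≤ height (m + 1) B ^ (-μ)}.Finite := by
  have ht := S.one_lt_base
  have ht0 : (0 : ℝ) < S.θ := by linarith
  have ht5 : (5 : ℝ) ≤ S.θ := by exact_mod_cast S.five_le
  have hy := one_le_norm_limit (S := S) (r := r) hw
  have hP1 : 1 ≤ P := by
    have h1 := hP 0
    have h2 := one_le_alpha hγ (0 + (m + 1))
    rw [show alpha γ 0 = 1 from rfl, mul_one] at h1
    linarith
  set y := ‖limit S w r‖ with hydef
  obtain ⟨K, hK⟩ : ∃ K : ℝ, 2 * y < (S.θ : ℝ) ^ K := by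
    refine ⟨Real.logb S.θ (2 * y + 1), ?_⟩
    rw [Real.rpow_logb ht0 ht.ne' (by positivity)]
    linarith
  -- The first entry excludes `N = 0` below; the second makes `(μ - P) h` outweigh all constants.
  set h₀ : ℝ := max (alpha γ 1) ((K + 3 * P) / (μ - P)) with hh₀
  refine (finite_height_le (r + 2) (m + 1) ((S.θ : ℝ) ^ h₀)).subset ?_
  rintro B ⟨hB, hψ⟩
  refine ⟨hB, ?_⟩
  by_contra! hlt
  rw [psi_one_span_singleton (limit_ne_zero hw) hB (by omega)] at hψ
  have hH1 := one_le_height hB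
  set h : ℝ := Real.logb S.θ (height (m + 1) B) with hh
  have hH : height (m + 1) B = (S.θ : ℝ) ^ h :=
    (Real.rpow_logb ht0 ht.ne' (by linarith)).symm
  have hh0 : h₀ < h := by
    rw [hH] at hlt
    exact (Real.rpow_lt_rpow_left_iff ht).1 hlt
  have hhα : alpha γ 1 < h := (le_max_left _ _).trans_lt hh0
  have hhK : K + 3 * P < h * (μ - P) := by
    rw [← div_lt_iff₀ (by linarith)]
    exact (le_max_right _ _).trans_lt hh0
  have hδ : height (m + 1) B ^ (-μ) = (S.θ : ℝ) ^ (-μ * h) := by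
    rw [hH, ← Real.rpow_mul ht0.le, mul_comm]
  rw [hδ] at hψ
  -- In the margin 3, a part 2 pays for the factor `6 ≤ θ²` and a part 1 for the integral part.
  have hex : ∃ N, h + 3 < alpha γ (N + 1) - alpha γ N := by
    obtain ⟨N, hN⟩ := exists_nat_gt (h + 3)
    refine ⟨N, ?_⟩
    linarith [two_mul_alpha_le hγ N, succ_le_alpha hγ N]
  classical
  obtain ⟨N, hN, hmin⟩ : ∃ N, h + 3 < alpha γ (N + 1) - alpha γ N ∧
      ∀ M < N, alpha γ (M + 1) - alpha γ M ≤ h + 3 :=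
    ⟨Nat.find hex, Nat.find_spec hex, fun M hM => not_lt.1 (Nat.find_min hex hM)⟩
  obtain ⟨M, rfl⟩ : ∃ M, N = M + 1 := by
    refine Nat.exists_eq_succ_of_ne_zero ?_
    rintro rfl
    linarith [one_le_alpha hγ 0]
  have hM := hmin M (Nat.lt_succ_self M)
  -- Minimality bounds the preceding gap by `h + 3`, and the golden ratio inequality carries this
  -- over to the last partial sum needed.
  have hαM : alpha γ (M + 1 + m) ≤ (P - 1) * (h + 3) := by
    have h1 := alpha_add_le_mul_gap hγ (hP M)
    rw [show M + 1 + m = M + (m + 1) by ring]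
    exact h1.trans (by gcongr)
  have hmem : ∀ i ≤ m, approx S w r (M + 1 + i) ∈ B := by
    intro i hi
    refine approx_mem_of_omegaMin_le hw (by omega) hB hψ ?_ ?_
    · have h1 : h + 3 < alpha γ (M + 1 + i + 1) - alpha γ (M + 1 + i) :=
        hN.trans_le (alpha_gap_monotone hγ (Nat.le_add_right _ _))
      have h6 : (6 : ℝ) ≤ (S.θ : ℝ) ^ (2 : ℝ) := by
        rw [Real.rpow_two]; nlinarith
      calc 6 * height (m + 1) B * S.q (M + 1 + i)
          ≤ (S.θ : ℝ) ^ (2 : ℝ) * (S.θ : ℝ) ^ h * (S.θ : ℝ) ^ alpha γ (M + 1 + i) := by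
            rw [hH]
            have := Scale.q_le hS hγ (M + 1 + i)
            have := (S.q_pos (M + 1 + i)).le
            gcongr
        _ = (S.θ : ℝ) ^ (2 + h + alpha γ (M + 1 + i)) := by
            rw [Real.rpow_add ht0, Real.rpow_add ht0]
        _ ≤ (S.θ : ℝ) ^ (alpha γ (M + 1 + i + 1) - 1) :=
            Real.rpow_le_rpow_of_exponent_le ht.le (by linarith)
        _ ≤ _ := Scale.le_q hS _
    · have h1 : alpha γ (M + 1 + i) ≤ alpha γ (M + 1 + m) := alpha_monotone hγ (by omega)
      calc 2 * y * (S.θ : ℝ) ^ (-μ * h) * height (m + 1) B * S.q (M + 1 + i)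
          < (S.θ : ℝ) ^ K * (S.θ : ℝ) ^ (-μ * h) * (S.θ : ℝ) ^ h * S.q (M + 1 + i) := by
            rw [hH]
            have := S.q_pos (M + 1 + i)
            gcongr
        _ ≤ (S.θ : ℝ) ^ K * (S.θ : ℝ) ^ (-μ * h) * (S.θ : ℝ) ^ h *
            (S.θ : ℝ) ^ alpha γ (M + 1 + i) := by
            have := Scale.q_le hS hγ (M + 1 + i)
            gcongr
        _ = (S.θ : ℝ) ^ (K + -μ * h + h + alpha γ (M + 1 + i)) := by
            rw [Real.rpow_add ht0, Real.rpow_add ht0, Real.rpow_add ht0]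
        _ ≤ (S.θ : ℝ) ^ (0 : ℝ) :=
            Real.rpow_le_rpow_of_exponent_le ht.le (by nlinarith)
        _ = 1 := Real.rpow_zero _
  have hBeq : approxSpan S w r (M + 1) m = B := by
    refine Submodule.eq_of_le_of_finrank_eq (approxSpan_le hw hmem) ?_
    rw [finrank_of_mem_rationalSubspaces hB,
      finrank_of_mem_rationalSubspaces (approxSpan_mem_rationalSubspaces hm)]
  -- Height and distance of the identified subspace now give `μ h ≤ K + P α_{M+1} ≤ K + P (h + 1)`,
  -- contrary to `hhK`.
  have h1 : alpha γ (M + 1) - 1 ≤ h := by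
    have h2 := (Scale.le_q hS (M + 1)).trans (q_le_height (S := S) (N := M + 1) hw hm)
    rw [hBeq, hH] at h2
    exact (Real.rpow_le_rpow_left_iff ht).1 h2
  have h2 := le_omegaMin_mul_norm (limit_ne_zero (S := S) (r := r) hw)
    (ne_bot_of_mem_rationalSubspaces (by omega) hB)
    (K := (S.q (M + 1 + (m + 1)))⁻¹ / 2) fun b hb => by
      have := inv_q_le_norm_limit_sub (S := S) hw hm (hBeq ▸ hb)
      linarith
  have h3 : (S.θ : ℝ) ^ (μ * h) ≤ (S.θ : ℝ) ^ (K + P * alpha γ (M + 1)) := by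
    have h4 : (S.q (M + 1 + (m + 1)))⁻¹ ≤ 2 * y * (S.θ : ℝ) ^ (-μ * h) := by
      have : omegaMin (Submodule.span ℝ {limit S w r}) B * y ≤ (S.θ : ℝ) ^ (-μ * h) * y := by
        gcongr
      linarith
    have hq := S.q_pos (M + 1 + (m + 1))
    rw [neg_mul, Real.rpow_neg ht0.le, ← div_eq_mul_inv, inv_eq_one_div,
      div_le_div_iff₀ hq (by positivity), one_mul] at h4
    refine h4.trans ?_
    rw [Real.rpow_add ht0]
    refine mul_le_mul hK.le ((Scale.q_le hS hγ _).trans ?_) hq.le (by positivity)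
    exact Real.rpow_le_rpow_of_exponent_le ht.le (hP _)
  have h4 := (Real.rpow_le_rpow_left_iff ht).1 h3
  nlinarith

end Bounds

/-! ### Choice of digits giving algebraically independent sums. -/

theorem countable_adjoin {s : Set ℝ} (hs : s.Countable) : Countable (Algebra.adjoin ℚ s) := by
  rw [← Cardinal.mk_le_aleph0_iff]
  refine (Algebra.cardinalMk_adjoin_le ℚ s).trans ?_
  simp [hs.le_aleph0]

/-- From uncountable sets of real numbers one can choose algebraically independent elements. -/
theorem exists_algebraicIndependent_mem {ι : Type*} [Finite ι] {A : ι → Set ℝ}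
    (hA : ∀ i, ¬ (A i).Countable) :
    ∃ x : ι → ℝ, (∀ i, x i ∈ A i) ∧ AlgebraicIndependent ℚ x := by
  classical
  have := Fintype.ofFinite ι
  suffices h : ∀ s : Finset ι, ∃ x : ι → ℝ, (∀ i, x i ∈ A i) ∧
      AlgebraicIndepOn ℚ x (s : Set ι) by
    obtain ⟨x, hx, hi⟩ := h Finset.univ
    rw [Finset.coe_univ, AlgebraicIndepOn.univ] at hi
    exact ⟨x, hx, hi⟩
  intro s
  induction s using Finset.induction_on with
  | empty =>
    have hne : ∀ i, (A i).Nonempty := fun i => by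
      rw [Set.nonempty_iff_ne_empty]
      intro h
      exact hA i (by rw [h]; exact Set.countable_empty)
    choose x hx using hne
    refine ⟨x, hx, ?_⟩
    rw [AlgebraicIndepOn, Finset.coe_empty]
    exact algebraicIndependent_empty_type
  | insert i s hi ih =>
    obtain ⟨x, hx, hind⟩ := ih
    have hcount : Countable (Algebra.adjoin ℚ (x '' (s : Set ι))) :=
      countable_adjoin (s.countable_toSet.image x)
    -- Only countably many reals are algebraic over a countable ring.
    have hnot : ¬ A i ⊆ {a | IsAlgebraic (Algebra.adjoin ℚ (x '' (s : Set ι))) a} := fun hsub =>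
      hA i ((Algebraic.countable _ ℝ).mono hsub)
    obtain ⟨a, haA, ha⟩ := Set.not_subset.1 hnot
    have himg : Function.update x i a '' (s : Set ι) = x '' (s : Set ι) := by
      refine Set.image_congr fun k hk => Function.update_of_ne ?_ _ _
      rintro rfl
      exact hi hk
    refine ⟨Function.update x i a, fun k => ?_, ?_⟩
    · by_cases hk : k = i
      · subst hk; simpa using haA
      · simpa [hk] using hx k
    · rw [Finset.coe_insert]
      refine AlgebraicIndepOn.insert ?_ ?_
      · have hcongr : (fun k : (s : Set ι) => Function.update x i a k) =
            fun k : (s : Set ι) => x k := by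
          funext k
          refine Function.update_of_ne ?_ _ _
          rintro h
          exact hi (h ▸ k.2)
        rw [AlgebraicIndepOn, hcongr]
        exact hind
      · rw [himg, Function.update_self]
        exact ha

section Digits

variable (S : Scale) (r : ℕ)

/-- The first nonzero term `1 / q k₀` dominates the tail, which is at most `3 / q (k₀ + 1) ≤ (3/5) /
q k₀`. -/
theorem tsum_div_q_ne_zero {d : ℕ → ℝ} (hd : ∀ k, |d k| ≤ 1) {k₀ : ℕ} (h0 : ∀ k < k₀, d k = 0)
    (h1 : |d k₀| = 1) : ∑' k, d k / S.q k ≠ 0 := by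
  have hb : ∀ k m, ‖d (k + m) / S.q (k + m)‖ ≤ 2 / S.q (k + m) := fun k m => by
    have := S.q_pos (k + m)
    rw [norm_div, Real.norm_eq_abs, Real.norm_eq_abs, abs_of_pos this]
    exact div_le_div_of_nonneg_right ((hd _).trans (by norm_num)) this.le
  have hs : Summable fun k => d k / S.q k :=
    (S.norm_tsum_le (k := 0) (f := fun k => d k / S.q k) fun m => by
      simpa using hb 0 m).1
  intro h
  rw [← hs.sum_add_tsum_nat_add (k₀ + 1), Finset.sum_range_succ,
    Finset.sum_eq_zero fun k hk => by rw [h0 k (by simpa using hk), zero_div], zero_add] at h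
  have h2 := (S.norm_tsum_le (k := k₀ + 1)
    (f := fun m => d (k₀ + 1 + m) / S.q (k₀ + 1 + m)) (hb (k₀ + 1))).2
  simp only [add_comm (k₀ + 1)] at h2
  rw [← neg_eq_of_add_eq_zero_right h, norm_neg, norm_div, Real.norm_eq_abs, h1,
    Real.norm_eq_abs, abs_of_pos (S.q_pos _), div_le_div_iff₀ (S.q_pos _) (S.q_pos _)] at h2
  linarith [S.five_mul_q_le k₀, S.q_pos k₀]

open Classical in
/-- The sum of the series over the indices congruent to `j`, with digits given by a set. -/
def digitSum (j : ℕ) (b : Set ℕ) : ℝ :=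
  ∑' k, (if k % (r + 1) = j then (if k / (r + 1) ∈ b then 2 else 1 : ℝ) else 0) / S.q k

theorem digitSum_injective {j : ℕ} (hj : j < r + 1) : Function.Injective (digitSum S r j) := by
  classical
  intro b b' h
  by_contra hne
  have hex : ∃ m, ¬ (m ∈ b ↔ m ∈ b') := by
    by_contra! hall
    exact hne (Set.ext hall)
  set f : Set ℕ → ℕ → ℝ := fun b k =>
    if k % (r + 1) = j then (if k / (r + 1) ∈ b then 2 else 1 : ℝ) else 0 with hf
  have hsum : ∀ b, Summable fun k => f b k / S.q k := fun b =>
    (S.norm_tsum_le (k := 0) (f := fun k => f b k / S.q k) fun m => by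
      have := S.q_pos m
      rw [zero_add, norm_div, Real.norm_eq_abs, Real.norm_eq_abs, abs_of_pos this]
      refine div_le_div_of_nonneg_right ?_ this.le
      simp only [hf]
      split_ifs <;> norm_num).1
  have hsub : ∑' k, (f b k - f b' k) / S.q k = 0 := by
    simp only [sub_div]
    rw [(hsum b).tsum_sub (hsum b'), sub_eq_zero]
    exact h
  -- Digit differences lie in {-1, 0, 1}; `k₀` is the index in the class of `j` attached to the
  -- least integer where `b` and `b'` differ.
  refine tsum_div_q_ne_zero S (d := fun k => f b k - f b' k) (fun k => ?_)
    (k₀ := (r + 1) * Nat.find hex + j) (fun k hk => ?_) ?_ hsub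
  · simp only [hf]
    split_ifs <;> norm_num
  · simp only [hf]
    by_cases hkj : k % (r + 1) = j
    · have hlt : k / (r + 1) < Nat.find hex := by
        have := Nat.div_add_mod k (r + 1)
        refine lt_of_not_ge fun hge => ?_
        have := Nat.mul_le_mul_left (r + 1) hge
        omega
      have := not_not.1 (Nat.find_min hex hlt)
      simp only [this, sub_self]
    · simp [hkj]
  · have hmod : ((r + 1) * Nat.find hex + j) % (r + 1) = j := by
      rw [Nat.mul_add_mod, Nat.mod_eq_of_lt hj]
    have hdiv : ((r + 1) * Nat.find hex + j) / (r + 1) = Nat.find hex := by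
      rw [Nat.mul_add_div (by omega), Nat.div_eq_of_lt hj, add_zero]
    have hspec := Nat.find_spec hex
    simp only [hf, hmod, hdiv, if_true]
    by_cases h1 : Nat.find hex ∈ b <;> by_cases h2 : Nat.find hex ∈ b'
    · exact absurd (iff_of_true h1 h2) hspec
    · rw [if_pos h1, if_neg h2]; norm_num
    · rw [if_neg h1, if_pos h2]; norm_num
    · exact absurd (iff_of_false h1 h2) hspec

theorem not_countable_range_digitSum {j : ℕ} (hj : j < r + 1) :
    ¬ (Set.range (digitSum S r j)).Countable := by
  intro h
  have := h.to_subtype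
  have : Countable (Set ℕ) :=
    (Equiv.ofInjective _ (digitSum_injective S r hj)).injective.countable
  obtain ⟨f, hf⟩ := exists_surjective_nat (Set ℕ)
  exact Function.cantor_surjective f hf

variable {S r} in
theorem term_apply_succ (w : ℕ → ℕ) (k : ℕ) (j : Fin (r + 1)) :
    term S w r k j.succ = ((if k % (r + 1) = j then w k else 0 : ℕ) : ℝ) / S.q k := by
  have h : idx r k = j.succ ↔ k % (r + 1) = j := by
    rw [idx, Fin.succ_inj, Fin.ext_iff]
  rw [term_apply]
  by_cases hk : k % (r + 1) = j
  · rw [if_pos (h.2 hk), if_pos hk]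
  · rw [if_neg (mt h.1 hk), if_neg hk, Nat.cast_zero, zero_div]

/-- Distinct coordinates use disjoint residue classes, so digits chosen independently for each
coordinate interleave into a single sequence. -/
theorem exists_digits_algebraicIndependent :
    ∃ w, IsDigits w ∧ AlgebraicIndependent ℚ fun j : Fin (r + 1) => limit S w r j.succ := by
  classical
  obtain ⟨x, hx, hind⟩ := exists_algebraicIndependent_mem
    (A := fun j : Fin (r + 1) => Set.range (digitSum S r j))
    fun j => not_countable_range_digitSum S r j.2
  choose b hb using hx
  set w : ℕ → ℕ := fun k =>
    if k / (r + 1) ∈ b ⟨k % (r + 1), Nat.mod_lt _ r.succ_pos⟩ then 2 else 1 with hwdef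
  have hw : IsDigits w := fun k => by
    simp only [hwdef]; split_ifs <;> simp
  refine ⟨w, hw, ?_⟩
  have heq : (fun j : Fin (r + 1) => limit S w r j.succ) = x := by
    funext j
    rw [← hb j, ← (hasSum_limit_apply_succ hw j).tsum_eq, digitSum]
    refine tsum_congr fun k => ?_
    rw [term_apply_succ]
    by_cases hk : k % (r + 1) = j
    · have h1 : (⟨k % (r + 1), Nat.mod_lt _ r.succ_pos⟩ : Fin (r + 1)) = j := Fin.ext hk
      rw [if_pos hk, if_pos hk]
      simp only [hwdef, h1]
      split_ifs <;> norm_num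
    · rw [if_neg hk, if_neg hk, Nat.cast_zero, zero_div]
  rw [heq]
  exact hind

theorem int_coeffs_eq_zero {ι : Type*} [Fintype ι] {σ : ι → ℝ} (hσ : AlgebraicIndependent ℚ σ)
    {c₀ : ℤ} {c : ι → ℤ} (h : (c₀ : ℝ) + ∑ i, c i * σ i = 0) : c₀ = 0 ∧ ∀ i, c i = 0 := by
  classical
  set p : MvPolynomial ι ℚ := MvPolynomial.C (c₀ : ℚ) +
    ∑ i, MvPolynomial.C (c i : ℚ) * MvPolynomial.X i with hp
  have h0 : p = 0 := by
    refine hσ.eq_zero_of_aeval_eq_zero p ?_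
    simpa [hp] using h
  have hc₀ : c₀ = 0 := by
    have := congrArg MvPolynomial.constantCoeff h0
    simpa [hp] using this
  refine ⟨hc₀, fun i => ?_⟩
  have := congrArg (MvPolynomial.aeval fun k => if k = i then (1 : ℚ) else 0) h0
  simpa [hp, hc₀] using this

/-! ### Irrationality of the line and the value of its exponents. -/

theorem limit_notMem {S : Scale} {r : ℕ} {w : ℕ → ℕ} (hw : IsDigits w)
    (hind : AlgebraicIndependent ℚ fun j : Fin (r + 1) => limit S w r j.succ) {e : ℕ}
    (he : e ≤ r + 1) {B : Submodule ℝ (E (r + 2))} (hB : B ∈ rationalSubspaces (r + 2) e) :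
    limit S w r ∉ B := by
  intro hmem
  obtain ⟨η, hη⟩ := exists_isPrimitivePlucker hB
  have hne : ∃ i, (EuclideanSpace.single i 1 : E (r + 2)) ∉ B := by
    by_contra! hall
    have htop : B = ⊤ := by
      rw [eq_top_iff, ← (EuclideanSpace.basisFun (Fin (r + 2)) ℝ).toBasis.span_eq,
        Submodule.span_le]
      rintro _ ⟨i, rfl⟩
      simpa using hall i
    have := finrank_of_mem_rationalSubspaces hB
    rw [htop, finrank_top, finrank_euclideanSpace_fin] at this
    omega
  obtain ⟨i, hi⟩ := hne
  rw [hη.mem_iff] at hi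
  push Not at hi
  obtain ⟨s, hs⟩ := hi
  have h0 := (hη.mem_iff _).1 hmem s
  -- The coefficients of an integer linear form that vanishes on `B` but not at the basis vector of
  -- index `i`; its vanishing at the limit would make every coefficient zero.
  set c : Fin (r + 2) → ℤ := fun k => ∑ j : Fin (e + 1),
    if s j = k then (-1) ^ (j : ℕ) * η ((Fin.succAboveOrderEmb j).trans s) else 0 with hc
  have hcy : ∀ y : E (r + 2), wedgeCoord (fun t => (η t : ℝ)) s y = ∑ k, c k * y k := fun y => by
    simp only [hc, Int.cast_sum, Finset.sum_mul]
    rw [Finset.sum_comm, wedgeCoord]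
    refine Finset.sum_congr rfl fun j _ => ?_
    rw [Finset.sum_eq_single (s j)]
    · simp; ring
    · intro k _ hk
      simp [hk.symm]
    · simp
  rw [hcy, Fin.sum_univ_succ, limit_apply_zero hw, mul_one] at h0
  obtain ⟨h1, h2⟩ := int_coeffs_eq_zero hind (c := fun j => c j.succ) h0
  apply hs
  rw [hcy]
  refine Finset.sum_eq_zero fun k _ => ?_
  have : c k = 0 := Fin.cases h1 h2 k
  rw [this]; simp

theorem span_limit_mem_irrationalSubspaces {S : Scale} {r : ℕ} {w : ℕ → ℕ} (hw : IsDigits w)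
    (hind : AlgebraicIndependent ℚ fun j : Fin (r + 1) => limit S w r j.succ) {e : ℕ}
    (he : e ≤ r + 1) :
    Submodule.span ℝ {limit S w r} ∈ irrationalSubspaces (r + 2) 1 e 1 := by
  refine ⟨finrank_span_singleton (limit_ne_zero hw), fun B hB => ?_⟩
  have hbot : Submodule.span ℝ {limit S w r} ⊓ B = ⊥ := by
    rw [← disjoint_iff, disjoint_comm,
      Submodule.disjoint_span_singleton' (limit_ne_zero hw)]
    exact limit_notMem hw hind he hB
  rw [hbot, finrank_bot]
  omega

theorem exponent_eq {S : Scale} {γ : ℕ → ℝ} {r : ℕ} {w : ℕ → ℕ} (hS : S.IsFloor γ)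
    (hγ : ∀ k, 1 ≤ k → 2 + (Real.sqrt 5 - 1) / 2 ≤ γ k) (hw : IsDigits w) {m : ℕ} (hm : m ≤ r)
    {P : ℝ} (hP : ∀ N, alpha γ (N + (m + 1)) ≤ P * alpha γ N)
    (hP' : ∀ K : ℕ, ∃ N ≥ K, alpha γ (N + (m + 1)) = P * alpha γ N) :
    exponent (Submodule.span ℝ {limit S w r}) (m + 1) 1 = (P : EReal) := by
  have hP0 : 0 < P := by
    have h1 := hP 0
    have h2 := one_le_alpha hγ (0 + (m + 1))
    rw [show alpha γ 0 = 1 from rfl, mul_one] at h1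
    linarith
  refine le_antisymm (sSup_le ?_) ?_
  · rintro _ ⟨μ, ⟨-, hinf⟩, rfl⟩
    refine EReal.coe_le_coe_iff.2 (not_lt.1 fun hlt => ?_)
    exact hinf (finite_of_lt hS hγ hw hm hlt hP)
  · refine le_of_forall_lt fun c hc => ?_
    -- Only positive `μ` are admitted in the supremum, hence the truncation at 0.
    have hc' : max c 0 < (P : EReal) := max_lt hc (by exact_mod_cast hP0)
    obtain ⟨μ, h1, h2⟩ := EReal.lt_iff_exists_real_btwn.1 hc'
    have hμ0 : 0 < μ := by exact_mod_cast (le_max_right c 0).trans_lt h1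
    refine ((le_max_left c 0).trans_lt h1).trans_le (le_sSup ⟨μ, ⟨hμ0, ?_⟩, rfl⟩)
    exact infinite_of_lt hS hγ hw hm hμ0 (EReal.coe_lt_coe_iff.1 h2) hP'

theorem periodic_add_mul {γ : ℕ → ℝ} {T : ℕ} (hper : ∀ k, 1 ≤ k → γ (k + T) = γ k) {k : ℕ}
    (hk : 1 ≤ k) (c : ℕ) : γ (k + c * T) = γ k := by
  induction c with
  | zero => simp
  | succ c ih => rw [Nat.succ_mul, ← add_assoc, hper _ (by omega), ih]

theorem prod_add_mul {γ : ℕ → ℝ} {T : ℕ} (hper : ∀ k, 1 ≤ k → γ (k + T) = γ k) (N c e : ℕ) :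
    ∏ l ∈ Finset.Icc 1 e, γ (N + c * T + l) = ∏ l ∈ Finset.Icc 1 e, γ (N + l) := by
  refine Finset.prod_congr rfl fun l hl => ?_
  have hl1 := (Finset.mem_Icc.1 hl).1
  rw [show N + c * T + l = N + l + c * T by ring, periodic_add_mul hper (by omega)]

/-- By periodicity the ratio `α_{N+e} / α_N` depends only on `N` modulo `T`, so its maximum is
attained along a whole arithmetic progression. -/
theorem exponent_eq_sup {S : Scale} {γ : ℕ → ℝ} {r : ℕ} {w : ℕ → ℕ} (hS : S.IsFloor γ)
    (hγ : ∀ k, 1 ≤ k → 2 + (Real.sqrt 5 - 1) / 2 ≤ γ k) (hw : IsDigits w) {T : ℕ} (hT : 0 < T)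
    (hper : ∀ k, 1 ≤ k → γ (k + T) = γ k) {e : ℕ} (he : 1 ≤ e) (her : e ≤ r + 1) :
    exponent (Submodule.span ℝ {limit S w r}) e 1 =
      (((Finset.range T).sup' (Finset.nonempty_range_iff.mpr hT.ne')
        (fun i => ∏ l ∈ Finset.Icc 1 e, γ (i + l)) : ℝ) : EReal) := by
  obtain ⟨m, rfl⟩ : ∃ m, e = m + 1 := ⟨e - 1, by omega⟩
  refine exponent_eq hS hγ hw (by omega) (fun N => ?_) fun K => ?_
  · have hα := one_le_alpha hγ N
    rw [alpha_add]
    refine mul_le_mul_of_nonneg_right ?_ (by linarith)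
    have h := prod_add_mul hper (N % T) (N / T) (m + 1)
    rw [mul_comm, Nat.mod_add_div] at h
    rw [h]
    exact Finset.le_sup' (fun i => ∏ l ∈ Finset.Icc 1 (m + 1), γ (i + l))
      (Finset.mem_range.2 (Nat.mod_lt N hT))
  · obtain ⟨i, -, hi⟩ := Finset.exists_mem_eq_sup' (Finset.nonempty_range_iff.mpr hT.ne')
      (fun i => ∏ l ∈ Finset.Icc 1 (m + 1), γ (i + l))
    refine ⟨i + K * T, ?_, ?_⟩
    · have := Nat.le_mul_of_pos_right K hT
      omega
    · rw [hi, alpha_add, prod_add_mul hper]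

end Digits

end SubspaceApprox

end

theorem mainTheorem7 (n : ℕ) (hn : 2 ≤ n) (γ : ℕ → ℝ) (T : ℕ) (hT : 0 < T)
    (hγ : ∀ k, 1 ≤ k → 2 + (Real.sqrt 5 - 1) / 2 ≤ γ k)
    (hper : ∀ k, 1 ≤ k → γ (k + T) = γ k)
    (θ : ℕ) (hθ : θ.Prime) (hθ5 : 5 ≤ θ) :
    ∃ (u : Fin (n - 1) → ℕ → ℕ) (σ : Fin (n - 1) → ℝ) (Y : SubspaceApprox.E n)
      (A : Submodule ℝ (SubspaceApprox.E n)),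
      (∀ (j : Fin (n - 1)) (k : ℕ), (k % (n - 1) = (j : ℕ) → u j k = 1 ∨ u j k = 2) ∧
        (k % (n - 1) ≠ (j : ℕ) → u j k = 0)) ∧
      (∀ j : Fin (n - 1), HasSum (fun k : ℕ => (u j k : ℝ) / (θ : ℝ) ^ ⌊SubspaceApprox.alpha γ k⌋₊) (σ j)) ∧
      AlgebraicIndependent ℚ σ ∧
      Y ⟨0, by omega⟩ = 1 ∧
      (∀ j : Fin (n - 1), Y ⟨(j : ℕ) + 1, by omega⟩ = σ j) ∧
      A = Submodule.span ℝ {Y} ∧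
      (∀ e, 1 ≤ e → e ≤ n - 1 → A ∈ SubspaceApprox.irrationalSubspaces n 1 e 1) ∧
      ∀ e, 1 ≤ e → e ≤ n - 1 →
        SubspaceApprox.exponent A e 1 =
          (((Finset.range T).sup' (Finset.nonempty_range_iff.mpr hT.ne')
            (fun i => ∏ l ∈ Finset.Icc 1 e, γ (i + l)) : ℝ) : EReal) := by
  obtain ⟨r, rfl⟩ : ∃ r, n = r + 2 := ⟨n - 2, by omega⟩
  set S := SubspaceApprox.alphaScale θ hθ hθ5 hγ with hSdef
  have hS : S.IsFloor γ := fun _ => rfl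
  obtain ⟨w, hw, hind⟩ := SubspaceApprox.exists_digits_algebraicIndependent S r
  refine ⟨fun j k => if k % (r + 1) = j then w k else 0,
    fun j : Fin (r + 1) => SubspaceApprox.limit S w r j.succ, SubspaceApprox.limit S w r, _,
    fun j k => ⟨fun h => ?_, fun h => if_neg h⟩, fun j => ?_, hind,
    SubspaceApprox.limit_apply_zero hw, fun j => rfl, rfl,
    fun e _ he => SubspaceApprox.span_limit_mem_irrationalSubspaces hw hind he,
    fun e he he' => SubspaceApprox.exponent_eq_sup hS hγ hw hT hper he he'⟩
  · have h' : k % (r + 1) = j := h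
    simp only [h', if_true]
    exact hw k
  · have h := SubspaceApprox.hasSum_limit_apply_succ (S := S) hw j
    simp only [SubspaceApprox.term_apply_succ] at h
    exact h
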